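/- Fix a real number $a>0$. The Buckley–Osthus random graph $H_{a,1}^n$ (loops allowed) is defined inductively: $H_{a,1}^0$ is the empty graph, and $H_{a,1}^{t}$ is obtained from $H_{a,1}^{t-1}$ by adding the vertex $t$ and one edge between $t$ and a random vertex $i$, where $$\Pr(i=s)=\begin{cases}\dfrac{d_{H_{a,1}^{t-1}}(s)-1+a}{(a+1)t-1}, & 1\le s\le t-1,\\[2mm] \dfrac{a}{(a+1)t-1}, & s=t,\end{cases}$$ and $d_H(s)$ is the degree of $s$ in $H$ (a loop contributes $2$); in particular $H_{a,1}^1$ is one vertex with one loop. For a vertex $t$ of $H_{a,1}^n$ let $d(t)$ be its degree in $H_{a,1}^n$ and let the second degree $d_2(t)$ be the number of edges $ij$ of $H_{a,1}^n$ (a loop $ii$ being one edge) with $i\ne t$, $j\neq t$ and $it\in H_{a,1}^n$, that is, the number of edges incident to a neighbour of $t$ but not to $t$. Let $$N_n(l,k)=\#\{t\in H_{a,1}^n:\ d(t)=l,\ d_2(t)=k,\ tt\notin H_{a,1}^n\}.$$ Define constants $c(k)=\dfrac{\mathrm B(k-1+a,a+2)}{\mathrm B(a,a+1)}$ for $k\ge1$,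 with $\mathrm B$ the Beta function, and $c(l,k)$ for integers $l,k\ge 0$ by \begin{align*} c(l,0)&=c(0,k)=0,\\ c(1,k)&=c(1,k-1)\frac{a+k-1}{k+3a+1}+c(k)\frac{a+k-1}{k+3a+1},\quad k>0,\\ c(l,k)&=c(l,k-1)\frac{al+k-1}{l(1+a)+k+2a}+c(l-1,k)\frac{l-2+a}{l(1+a)+k+2a},\quad k>0,\ l>1. \end{align*} Then there are a constant $C$ depending only on $a$ and real numbers $\theta(n,l,k)$ such that for all integers $n,l,k\ge0$ $$\mathbb E\,N_n(l,k)=c(l,k)\,\bigl(n+\theta(n,l,k)\bigr),$$ and $|\theta(n,l,k)|<C(l+k)^{1+a}$ whenever $l+k>0$. -/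

import Mathlib

open Classical in
/-- The degree of `v` in the graph with edge multiset `E`: a loop at `v` counts twice. -/
noncomputable def vertexDegree (E : Multiset (Sym2 ℕ)) (v : ℕ) : ℕ :=
  (E.filter fun e => v ∈ e).card + (E.filter fun e => e = s(v, v)).card

theorem vertexDegree_cons (e : Sym2 ℕ) (E : Multiset (Sym2 ℕ)) (v : ℕ) :
    vertexDegree (e ::ₘ E) v =
      vertexDegree E v + ((if v ∈ e then 1 else 0) + (if e = s(v, v) then 1 else 0)) := by
  classical
  unfold vertexDegree
  by_cases h1 : v ∈ e <;> by_cases h2 : e = s(v, v) <;> simp [h1, h2] <;> omega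

theorem sum_vertexDegree (n : ℕ) (E : Multiset (Sym2 ℕ)) (hE : ∀ e ∈ E, ∀ v ∈ e, v < n) :
    ∑ v ∈ Finset.range n, vertexDegree E v = 2 * E.card := by
  classical
  induction E using Multiset.induction_on with
  | empty => simp [vertexDegree]
  | cons e E ih =>
    have ih' := ih fun e' he' => hE e' (Multiset.mem_cons_of_mem he')
    have he := hE e (Multiset.mem_cons_self e E)
    simp only [vertexDegree_cons, Finset.sum_add_distrib, ih', Multiset.card_cons]
    suffices h : (∑ v ∈ Finset.range n, (if v ∈ e then 1 else 0)) +
        ∑ v ∈ Finset.range n, (if e = s(v, v) then 1 else 0) = 2 by omega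
    induction e using Sym2.ind with
    | _ x y =>
      have hx : x < n := he x (by simp)
      have hy : y < n := he y (by simp)
      by_cases hxy : x = y
      · subst hxy
        simp [hx]
      · have h1 : ∀ v, (if v ∈ s(x, y) then 1 else 0) =
            (if v = x then 1 else 0) + (if v = y then 1 else 0 : ℕ) := by
          intro v
          by_cases h1 : v = x <;> by_cases h2 : v = y <;> simp_all
        have h2 : ∀ v, (if s(x, y) = s(v, v) then 1 else 0 : ℕ) = 0 := by
          intro v
          rw [if_neg]
          intro h
          simp only [Sym2.eq_iff] at h
          omega
        simp only [h1, h2, Finset.sum_add_distrib]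
        simp [hx, hy]

/-- Graphs (loops and multiple edges allowed) with vertex set `{0, …, n - 1}`, exactly `n` edges
and no isolated vertex. All the graphs that the random process below visits have this form. -/
structure AttachmentGraph (n : ℕ) where
  /-- The edges. -/
  edges : Multiset (Sym2 ℕ)
  lt_of_mem : ∀ e ∈ edges, ∀ v ∈ e, v < n
  card_edges : edges.card = n
  one_le_degree : ∀ v < n, 1 ≤ vertexDegree edges v

namespace AttachmentGraph

variable {n : ℕ}

/-- The degree of a vertex. -/
noncomputable def degree (G : AttachmentGraph n) (v : ℕ) : ℕ := vertexDegree G.edges v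

open Classical in
/-- The second degree of `t`: the number of edges that have an end `i` adjacent to `t`, except for
the edges incident to `t` itself. -/
noncomputable def secondDegree (G : AttachmentGraph n) (t : ℕ) : ℕ :=
  (G.edges.filter fun e => t ∉ e ∧ ∃ i ∈ e, s(i, t) ∈ G.edges).card

open Classical in
/-- The number of vertices with degree `l`, with second degree `k`, and without a loop. -/
noncomputable def numVertices (G : AttachmentGraph n) (l k : ℕ) : ℕ :=
  ((Finset.range n).filter fun t =>
    G.degree t = l ∧ G.secondDegree t = k ∧ s(t, t) ∉ G.edges).card

/-- The graph without vertices and edges. -/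
def empty : AttachmentGraph 0 where
  edges := 0
  lt_of_mem := by simp
  card_edges := by simp
  one_le_degree := by simp

/-- Add the new vertex `n` and one edge between `n` and `i`, where `i = n` gives a loop. -/
def addEdge (G : AttachmentGraph n) (i : Fin (n + 1)) : AttachmentGraph (n + 1) where
  edges := s((i : ℕ), n) ::ₘ G.edges
  lt_of_mem := by
    intro e he v hv
    rcases Multiset.mem_cons.1 he with rfl | he
    · rcases Sym2.mem_iff.1 hv with rfl | rfl <;> omega
    · have := G.lt_of_mem e he v hv
      omega
  card_edges := by simp [G.card_edges]
  one_le_degree := by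
    intro v hv
    rw [vertexDegree_cons]
    rcases Nat.lt_succ_iff_lt_or_eq.1 hv with h | rfl
    · have := G.one_le_degree v h
      omega
    · simp only [Sym2.mem_iff, or_true, if_true]
      omega

/-- The probability that the new vertex `n`, the `(n + 1)`-st one, is joined to `i`. -/
noncomputable def attachProb (a : ℝ) (G : AttachmentGraph n) (i : Fin (n + 1)) : ℝ :=
  if (i : ℕ) < n then ((G.degree i : ℝ) - 1 + a) / ((a + 1) * ((n : ℝ) + 1) - 1)
  else a / ((a + 1) * ((n : ℝ) + 1) - 1)

theorem attachProb_nonneg {a : ℝ} (ha : 0 < a) (G : AttachmentGraph n) (i : Fin (n + 1)) :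
    0 ≤ attachProb a G i := by
  have hn : (0 : ℝ) ≤ n := Nat.cast_nonneg n
  have hD : 0 ≤ (a + 1) * ((n : ℝ) + 1) - 1 := by nlinarith [mul_nonneg ha.le hn]
  unfold attachProb
  split_ifs with h
  · have h1 : (1 : ℝ) ≤ G.degree i := by exact_mod_cast G.one_le_degree i h
    exact div_nonneg (by linarith) hD
  · exact div_nonneg ha.le hD

theorem sum_attachProb {a : ℝ} (ha : 0 < a) (G : AttachmentGraph n) :
    ∑ i, attachProb a G i = 1 := by
  have hn : (0 : ℝ) ≤ n := Nat.cast_nonneg n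
  have hD : 0 < (a + 1) * ((n : ℝ) + 1) - 1 := by nlinarith [mul_nonneg ha.le hn]
  have hdeg : ∑ v ∈ Finset.range n, (G.degree v : ℝ) = 2 * n := by
    have := sum_vertexDegree n G.edges G.lt_of_mem
    rw [G.card_edges] at this
    exact_mod_cast this
  rw [Fin.sum_univ_castSucc]
  simp only [attachProb, Fin.val_castSucc, Fin.is_lt, if_true, Fin.val_last, lt_irrefl, if_false]
  rw [← Finset.sum_div, ← add_div, div_eq_one_iff_eq hD.ne',
    Fin.sum_univ_eq_sum_range (fun v => (G.degree v : ℝ) - 1 + a) n]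
  simp only [Finset.sum_add_distrib, Finset.sum_sub_distrib, hdeg, Finset.sum_const,
    Finset.card_range, nsmul_eq_mul]
  ring

/-- The law of the vertex to which the new vertex is joined. -/
noncomputable def attachLaw (a : ℝ) (ha : 0 < a) (G : AttachmentGraph n) : PMF (Fin (n + 1)) :=
  PMF.ofFintype (fun i => ENNReal.ofReal (attachProb a G i)) (by
    rw [← ENNReal.ofReal_sum_of_nonneg fun i _ => attachProb_nonneg ha G i, sum_attachProb ha G,
      ENNReal.ofReal_one])

/-- The Buckley–Osthus random graph `H_{a,1}^n`. The first vertex gets a loop with probability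
`a / ((a + 1) - 1) = 1`. -/
noncomputable def buckleyOsthus (a : ℝ) (ha : 0 < a) : (n : ℕ) → PMF (AttachmentGraph n)
  | 0 => PMF.pure empty
  | n + 1 => (buckleyOsthus a ha n).bind fun G => (attachLaw a ha G).map G.addEdge

instance : MeasurableSpace (AttachmentGraph n) := ⊤

/-- The expectation of the number of vertices with degree `l`, with second degree `k`, and without
a loop in the Buckley–Osthus random graph on `n` vertices. -/
noncomputable def expectedNum (a : ℝ) (ha : 0 < a) (n l k : ℕ) : ℝ :=
  ∫ G, (G.numVertices l k : ℝ) ∂(buckleyOsthus a ha n).toMeasure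

end AttachmentGraph

/-- `c(k) = B(k - 1 + a, a + 2) / B(a, a + 1)`, with Euler's Beta function. -/
noncomputable def degreeConst (a : ℝ) (k : ℕ) : ℝ :=
  ProbabilityTheory.beta ((k : ℝ) - 1 + a) (a + 2) / ProbabilityTheory.beta a (a + 1)

/-- The constants `c(l, k)`. -/
noncomputable def secondDegreeConst (a : ℝ) (l k : ℕ) : ℝ :=
  if l = 0 ∨ k = 0 then 0
  else if l = 1 then
    secondDegreeConst a 1 (k - 1) * ((a + k - 1) / (k + 3 * a + 1)) +
      degreeConst a k * ((a + k - 1) / (k + 3 * a + 1))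
  else
    secondDegreeConst a l (k - 1) * ((a * l + k - 1) / (l * (1 + a) + k + 2 * a)) +
      secondDegreeConst a (l - 1) k * (((l : ℝ) - 2 + a) / (l * (1 + a) + k + 2 * a))
  termination_by l + k
  decreasing_by all_goals omega

/-! Each vertex arrives with a single edge, so apart from loops the graph is a forest without
multiple edges. Hence, for a loopless vertex of degree `l` and second degree `k`, the degrees of its
neighbours add up to `l + k + f`, where `f` counts the neighbours with a loop. This `f` is fixed at
birth and is 0 or 1. With D = (1+a)n + a the total weight, the next step raises `l` with probability
(l-1+a)/D and `k` with probability (al+k+f)/D. For each `f` the expected class sizes therefore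
satisfy a closed linear recurrence in `n`, fed at `l = 1` by the expected degree counts.

For f = 0 write r = l(1+a)+k+a-1 for the loss rate. The denominator in the recurrence of c(l,k) is R
= r + (1+a), and D grows by 1+a per step, so c(l,k)·D/(1+a) solves the recurrence of the class sizes
exactly. The error solves the homogeneous recurrence D·x' = (D-r)·x + (inflow). As long as r ≤ D,
any `b` whose own inflow is at most r·b is preserved as a bound (`le_of_recurrence`,
`abs_le_of_recurrence`). For b = c(l,k)·g(t) with t = l+k-1 this asks for R·g(t-1) ≤ r·g(t), and
g(t) = t^(1+a) qualifies because R - r = 1+a (`rpow_sub_one_mul_le`). This is the source of the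
exponent. Classes with l+k > n are empty and are estimated directly; the others satisfy r ≤ D.

At `l = 1` the error is bounded uniformly, and the lower bound c(1,k) ≥ const·k^(-1-a) brings this
into the required shape.

For f = 1 there is no main term, but `k` grows at a rate larger by one. The extra factor al+k in the
comparison function absorbs this exactly. Now R - r = a, so the remaining factor is (l+k-1)^a, and
the total is again of order c(l,k)·(l+k)^(1+a). -/

/-! ### Structure of the graphs that the process visits -/

namespace AttachmentGraph

variable {n : ℕ}

/-- The graphs that the attachment process can visit. -/
inductive Reachable : {n : ℕ} → AttachmentGraph n → Prop
  | empty : Reachable empty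
  | addEdge {n : ℕ} (G : AttachmentGraph n) (i : Fin (n + 1)) :
      Reachable G → Reachable (G.addEdge i)

theorem mem_edges_addEdge (G : AttachmentGraph n) (i : Fin (n + 1)) (e : Sym2 ℕ) :
    e ∈ (G.addEdge i).edges ↔ e = s((i : ℕ), n) ∨ e ∈ G.edges := by
  simp [addEdge]

theorem mk_notMem_edges (G : AttachmentGraph n) {x y : ℕ} (h : n ≤ x ∨ n ≤ y) :
    s(x, y) ∉ G.edges := by
  intro he
  have hx := G.lt_of_mem _ he x (by simp)
  have hy := G.lt_of_mem _ he y (by simp)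
  omega

theorem mk_mem_addEdge_of_lt (G : AttachmentGraph n) (i : Fin (n + 1)) {x y : ℕ} (hx : x < n)
    (hy : y < n) : s(x, y) ∈ (G.addEdge i).edges ↔ s(x, y) ∈ G.edges := by
  rw [mem_edges_addEdge, or_iff_right]
  rw [Sym2.eq_iff]
  omega

theorem mk_mem_addEdge_last (G : AttachmentGraph n) (i : Fin (n + 1)) (x : ℕ) :
    s(x, n) ∈ (G.addEdge i).edges ↔ x = i := by
  rw [mem_edges_addEdge, or_iff_left (G.mk_notMem_edges (Or.inr le_rfl)), Sym2.eq_iff]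
  have := i.2
  omega

theorem mk_mem_addEdge_last' (G : AttachmentGraph n) (i : Fin (n + 1)) (x : ℕ) :
    s(n, x) ∈ (G.addEdge i).edges ↔ x = i := by
  rw [Sym2.eq_swap, mk_mem_addEdge_last]

theorem Reachable.nodup {G : AttachmentGraph n} (hG : G.Reachable) : G.edges.Nodup := by
  induction hG with
  | empty => simp [AttachmentGraph.empty]
  | addEdge G i hG ih =>
    exact Multiset.nodup_cons.2 ⟨G.mk_notMem_edges (Or.inr le_rfl), ih⟩

/-- `1` if there is a loop at `v`, and `0` otherwise. -/
noncomputable def loopIndicator (G : AttachmentGraph n) (v : ℕ) : ℕ :=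
  open Classical in if s(v, v) ∈ G.edges then 1 else 0

theorem loopIndicator_addEdge_of_lt (G : AttachmentGraph n) (i : Fin (n + 1)) {v : ℕ}
    (hv : v < n) : (G.addEdge i).loopIndicator v = G.loopIndicator v := by
  simp only [loopIndicator, mk_mem_addEdge_of_lt G i hv hv]

theorem loopIndicator_addEdge_last (G : AttachmentGraph n) (i : Fin (n + 1)) :
    (G.addEdge i).loopIndicator n = if (i : ℕ) = n then 1 else 0 := by
  simp only [loopIndicator, mk_mem_addEdge_last, eq_comm]

theorem degree_addEdge_of_lt (G : AttachmentGraph n) (i : Fin (n + 1)) {v : ℕ} (hv : v < n) :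
    (G.addEdge i).degree v = G.degree v + if (i : ℕ) = v then 1 else 0 := by
  have h1 : s((i : ℕ), n) ≠ s(v, v) := by rw [Ne, Sym2.eq_iff]; omega
  have h2 : v ∈ s((i : ℕ), n) ↔ (i : ℕ) = v := by rw [Sym2.mem_iff]; omega
  simp only [degree, addEdge, vertexDegree_cons, h1, h2, if_false, add_zero]

theorem vertexDegree_eq_zero_of_le (G : AttachmentGraph n) {v : ℕ} (hv : n ≤ v) :
    vertexDegree G.edges v = 0 := by
  have h1 : ∀ e ∈ G.edges, ¬ v ∈ e := fun e he h => by
    have := G.lt_of_mem e he v h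
    omega
  have h2 : ∀ e ∈ G.edges, ¬ e = s(v, v) := fun e he h => h1 e he (by simp [h])
  classical
  simp only [vertexDegree, Multiset.filter_eq_nil.2 h1, Multiset.filter_eq_nil.2 h2,
    Multiset.card_zero]

theorem degree_addEdge_last (G : AttachmentGraph n) (i : Fin (n + 1)) :
    (G.addEdge i).degree n = if (i : ℕ) = n then 2 else 1 := by
  have h1 : s((i : ℕ), n) = s(n, n) ↔ (i : ℕ) = n := by rw [Sym2.eq_iff]; omega
  simp only [degree, addEdge, vertexDegree_cons, G.vertexDegree_eq_zero_of_le le_rfl, h1,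
    Sym2.mem_iff, or_true, if_true]
  split_ifs <;> rfl

open Classical in
theorem Reachable.degree_eq {G : AttachmentGraph n} (hG : G.Reachable) (v : ℕ) :
    G.degree v = (G.edges.filter fun e => v ∈ e).card + G.loopIndicator v := by
  rw [degree, vertexDegree, loopIndicator]
  congr 1
  have := Multiset.count_eq_card_filter_eq G.edges s(v, v)
  simp only [eq_comm] at this ⊢
  rw [← this, Multiset.count_eq_of_nodup hG.nodup]

open Classical in
-- Only joining a neighbour of `t` matters: a new vertex joined to `t` itself has no other edge to
-- contribute. Without a loop at `t` these two cases exclude each other.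
theorem secondDegree_addEdge_of_lt (G : AttachmentGraph n) (i : Fin (n + 1)) {t : ℕ}
    (ht : t < n) (hl : s(t, t) ∉ G.edges) :
    (G.addEdge i).secondDegree t =
      G.secondDegree t + if s((i : ℕ), t) ∈ G.edges then 1 else 0 := by
  have hi := i.2
  have hold : ∀ e ∈ G.edges, ((t ∉ e ∧ ∃ j ∈ e, s(j, t) ∈ (G.addEdge i).edges) ↔
      (t ∉ e ∧ ∃ j ∈ e, s(j, t) ∈ G.edges)) := by
    intro e he
    refine and_congr_right fun _ => exists_congr fun j => and_congr_right fun hj => ?_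
    exact mk_mem_addEdge_of_lt G i (G.lt_of_mem e he j hj) ht
  have hnew : (t ∉ s((i : ℕ), n) ∧ ∃ j ∈ s((i : ℕ), n), s(j, t) ∈ (G.addEdge i).edges) ↔
      s((i : ℕ), t) ∈ G.edges := by
    constructor
    · rintro ⟨h1, j, hj, h⟩
      simp only [Sym2.mem_iff, not_or] at h1 hj
      rcases hj with rfl | rfl
      · rcases (Nat.lt_succ_iff_lt_or_eq.1 hi) with h' | h'
        · exact (mk_mem_addEdge_of_lt G i h' ht).1 h
        · rw [h', mk_mem_addEdge_last'] at h
          omega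
      · rw [mk_mem_addEdge_last'] at h
        exact absurd h h1.1
    · intro h
      have h1 : t ≠ i := by rintro rfl; exact hl h
      have h2 := G.lt_of_mem _ h i (by simp)
      refine ⟨by simp only [Sym2.mem_iff]; omega, i, by simp, ?_⟩
      exact (mk_mem_addEdge_of_lt G i h2 ht).2 h
  let p : Sym2 ℕ → Prop := fun e => t ∉ e ∧ ∃ j ∈ e, s(j, t) ∈ (G.addEdge i).edges
  have key : (G.addEdge i).secondDegree t =
      (Multiset.filter p (s((i : ℕ), n) ::ₘ G.edges)).card := rfl
  rw [key]
  by_cases h : s((i : ℕ), t) ∈ G.edges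
  · rw [Multiset.filter_cons_of_pos (p := p) _ (hnew.2 h), Multiset.filter_congr hold, if_pos h]
    simp [secondDegree]
  · rw [Multiset.filter_cons_of_neg (p := p) _ (fun h' => h (hnew.1 h')),
      Multiset.filter_congr hold, if_neg h]
    simp [secondDegree]

/-- The second degree of the new vertex counts the old edges at `i`, where a loop counts once,
whereas the degree of `i` counts it twice. -/
theorem Reachable.secondDegree_addEdge_last {G : AttachmentGraph n} (hG : G.Reachable)
    (i : Fin (n + 1)) :
    (G.addEdge i).secondDegree n + G.loopIndicator i = G.degree i := by
  classical
  rw [hG.degree_eq]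
  congr 1
  have key : (G.addEdge i).secondDegree n = (Multiset.filter
      (fun e => n ∉ e ∧ ∃ j ∈ e, s(j, n) ∈ (G.addEdge i).edges)
      (s((i : ℕ), n) ::ₘ G.edges)).card := rfl
  rw [key, Multiset.filter_cons_of_neg _ (by simp)]
  congr 1
  refine Multiset.filter_congr fun e he => ?_
  simp only [mk_mem_addEdge_last, exists_eq_right, and_iff_right_iff_imp]
  intro _ h
  exact lt_irrefl _ (G.lt_of_mem e he n h)

theorem Reachable.two_le_degree {G : AttachmentGraph n} (hG : G.Reachable) {v : ℕ}
    (h : s(v, v) ∈ G.edges) : 2 ≤ G.degree v := by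
  classical
  rw [hG.degree_eq, loopIndicator, if_pos h]
  have : 0 < (G.edges.filter fun e => v ∈ e).card :=
    Multiset.card_pos_iff_exists_mem.2 ⟨s(v, v), Multiset.mem_filter.2 ⟨h, by simp⟩⟩
  omega

theorem Reachable.degree_le {G : AttachmentGraph n} (hG : G.Reachable) (v : ℕ) :
    G.degree v ≤ n + G.loopIndicator v := by
  classical
  rw [hG.degree_eq]
  have := Multiset.card_le_card (Multiset.filter_le (fun e => v ∈ e) G.edges)
  rw [G.card_edges] at this
  omega

theorem Reachable.degree_add_secondDegree_le {G : AttachmentGraph n} (hG : G.Reachable) {v : ℕ}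
    (h : s(v, v) ∉ G.edges) : G.degree v + G.secondDegree v ≤ n := by
  classical
  have h1 : (G.edges.filter fun e => v ∈ e).card + (G.edges.filter fun e => v ∉ e).card = n := by
    rw [← Multiset.card_add, Multiset.filter_add_not, G.card_edges]
  have h2 : G.secondDegree v ≤ (G.edges.filter fun e => v ∉ e).card :=
    Multiset.card_le_card (Multiset.monotone_filter_right _ fun _ h => h.1)
  rw [hG.degree_eq, loopIndicator, if_neg h]
  omega

/-- The vertex that `v` joined at birth already carried an edge, and second degrees never decrease.
This matches c(l,0) = 0. -/
theorem Reachable.one_le_secondDegree {G : AttachmentGraph n} (hG : G.Reachable) {v : ℕ}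
    (hv : v < n) (h : s(v, v) ∉ G.edges) : 1 ≤ G.secondDegree v := by
  induction hG with
  | empty => omega
  | @addEdge n G i hG ih =>
    rcases Nat.lt_succ_iff_lt_or_eq.1 hv with hv' | rfl
    · rw [mk_mem_addEdge_of_lt G i hv' hv'] at h
      rw [secondDegree_addEdge_of_lt G i hv' h]
      have := ih hv' h
      omega
    · rw [mk_mem_addEdge_last] at h
      have hi : (i : ℕ) < v := by omega
      have h1 := hG.secondDegree_addEdge_last i
      have h2 := G.one_le_degree i hi
      change 1 ≤ G.degree i at h2
      have h3 := @Reachable.two_le_degree _ G hG i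
      unfold loopIndicator at h1
      split_ifs at h1 with h4
      · have := h3 h4
        omega
      · omega

open Classical in
/-- The vertices adjacent to `t`. -/
noncomputable def neighbors (G : AttachmentGraph n) (t : ℕ) : Finset ℕ :=
  (Finset.range n).filter fun i => s(i, t) ∈ G.edges

theorem mem_neighbors (G : AttachmentGraph n) {t i : ℕ} :
    i ∈ G.neighbors t ↔ s(i, t) ∈ G.edges := by
  classical
  simp only [neighbors, Finset.mem_filter, Finset.mem_range, and_iff_right_iff_imp]
  intro h
  exact G.lt_of_mem _ h i (by simp)

theorem lt_of_mem_neighbors (G : AttachmentGraph n) {t i : ℕ} (h : i ∈ G.neighbors t) : i < n :=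
  G.lt_of_mem _ (G.mem_neighbors.1 h) i (by simp)

theorem neighbors_addEdge_of_lt (G : AttachmentGraph n) (i : Fin (n + 1)) {t : ℕ} (ht : t < n) :
    (G.addEdge i).neighbors t =
      if (i : ℕ) = t then insert n (G.neighbors t) else G.neighbors t := by
  ext x
  rw [mem_neighbors]
  rcases lt_trichotomy x n with hx | rfl | hx
  · rw [mk_mem_addEdge_of_lt G i hx ht]
    split_ifs <;> simp [mem_neighbors, hx.ne]
  · rw [mk_mem_addEdge_last']
    split_ifs with h
    · simp [h]
    · simp [mem_neighbors, Ne.symm h, G.mk_notMem_edges (Or.inl le_rfl)]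
  · have h1 := (G.addEdge i).mk_notMem_edges (x := x) (y := t) (by omega)
    split_ifs <;> simp [mem_neighbors, h1, G.mk_notMem_edges (Or.inl hx.le), hx.ne']

theorem neighbors_addEdge_last (G : AttachmentGraph n) (i : Fin (n + 1)) :
    (G.addEdge i).neighbors n = {(i : ℕ)} := by
  ext x
  rw [mem_neighbors, mk_mem_addEdge_last, Finset.mem_singleton]

/-- The number of neighbors of `t` that carry a loop. -/
noncomputable def loopNeighbors (G : AttachmentGraph n) (t : ℕ) : ℕ :=
  ∑ i ∈ G.neighbors t, G.loopIndicator i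

theorem notMem_neighbors_of_le (G : AttachmentGraph n) {t i : ℕ} (h : n ≤ i) :
    i ∉ G.neighbors t := fun h' => by
  have := G.lt_of_mem_neighbors h'
  omega

theorem loopNeighbors_addEdge_of_lt (G : AttachmentGraph n) (i : Fin (n + 1)) {t : ℕ}
    (ht : t < n) : (G.addEdge i).loopNeighbors t = G.loopNeighbors t := by
  have h : ∑ x ∈ G.neighbors t, (G.addEdge i).loopIndicator x = G.loopNeighbors t :=
    Finset.sum_congr rfl fun x hx =>
      loopIndicator_addEdge_of_lt G i (G.lt_of_mem_neighbors hx)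
  rw [loopNeighbors, neighbors_addEdge_of_lt G i ht]
  split_ifs with hi
  · rw [Finset.sum_insert (G.notMem_neighbors_of_le le_rfl), h, loopIndicator_addEdge_last,
      if_neg (by omega), zero_add]
  · exact h

theorem loopNeighbors_addEdge_last (G : AttachmentGraph n) (i : Fin (n + 1)) (hi : (i : ℕ) < n) :
    (G.addEdge i).loopNeighbors n = G.loopIndicator i := by
  rw [loopNeighbors, neighbors_addEdge_last, Finset.sum_singleton,
    loopIndicator_addEdge_of_lt G i hi]

theorem loopIndicator_le_one (G : AttachmentGraph n) (v : ℕ) : G.loopIndicator v ≤ 1 := by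
  unfold loopIndicator
  split_ifs <;> omega

/-- Only the neighbour chosen at the birth of `t` can carry a loop; later neighbours spent their own
edge on `t`. -/
theorem Reachable.loopNeighbors_le_one {G : AttachmentGraph n} (hG : G.Reachable) {t : ℕ}
    (ht : t < n) (hl : s(t, t) ∉ G.edges) : G.loopNeighbors t ≤ 1 := by
  induction hG with
  | empty => omega
  | @addEdge n G i hG ih =>
    rcases Nat.lt_succ_iff_lt_or_eq.1 ht with ht' | rfl
    · rw [loopNeighbors_addEdge_of_lt G i ht']
      rw [mk_mem_addEdge_of_lt G i ht' ht'] at hl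
      exact ih ht' hl
    · rw [mk_mem_addEdge_last] at hl
      rw [loopNeighbors_addEdge_last G i (by omega)]
      exact G.loopIndicator_le_one i

theorem Reachable.card_neighbors {G : AttachmentGraph n} (hG : G.Reachable) {t : ℕ}
    (ht : t < n) (hl : s(t, t) ∉ G.edges) : (G.neighbors t).card = G.degree t := by
  induction hG with
  | empty => omega
  | @addEdge n G i hG ih =>
    rcases Nat.lt_succ_iff_lt_or_eq.1 ht with ht' | rfl
    · rw [mk_mem_addEdge_of_lt G i ht' ht'] at hl
      rw [degree_addEdge_of_lt G i ht', ← ih ht' hl, neighbors_addEdge_of_lt G i ht']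
      split_ifs
      · rw [Finset.card_insert_of_notMem (G.notMem_neighbors_of_le le_rfl)]
      · rfl
    · rw [mk_mem_addEdge_last] at hl
      rw [neighbors_addEdge_last, degree_addEdge_last, if_neg (by omega), Finset.card_singleton]

/-- There are neither multiple edges nor triangles, hence the degrees of the neighbors of `t` add
up to its degree plus its second degree, except that a loop at a neighbor counts twice. -/
theorem Reachable.sum_degree_neighbors {G : AttachmentGraph n} (hG : G.Reachable) {t : ℕ}
    (ht : t < n) (hl : s(t, t) ∉ G.edges) :
    ∑ i ∈ G.neighbors t, G.degree i = G.degree t + G.secondDegree t + G.loopNeighbors t := by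
  induction hG with
  | empty => omega
  | @addEdge n G i hG ih =>
    rcases Nat.lt_succ_iff_lt_or_eq.1 ht with ht' | rfl
    · rw [mk_mem_addEdge_of_lt G i ht' ht'] at hl
      have h : ∑ x ∈ G.neighbors t, (G.addEdge i).degree x =
          ∑ x ∈ G.neighbors t, G.degree x + if s((i : ℕ), t) ∈ G.edges then 1 else 0 := by
        rw [Finset.sum_congr rfl fun x hx =>
          degree_addEdge_of_lt G i (G.lt_of_mem_neighbors hx), Finset.sum_add_distrib]
        simp [mem_neighbors]
      rw [degree_addEdge_of_lt G i ht', secondDegree_addEdge_of_lt G i ht' hl,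
        loopNeighbors_addEdge_of_lt G i ht', neighbors_addEdge_of_lt G i ht']
      split_ifs with hi h2
      · subst hi; exact absurd h2 hl
      · rw [Finset.sum_insert (G.notMem_neighbors_of_le le_rfl), h, ih ht' hl, if_neg h2,
          degree_addEdge_last, if_neg (by omega)]
        omega
      · rename_i h2
        rw [h, ih ht' hl, if_pos h2]
        omega
      · rename_i h2
        rw [h, ih ht' hl, if_neg h2]
        omega
    · rw [mk_mem_addEdge_last] at hl
      have hi : (i : ℕ) < t := by omega
      have := hG.secondDegree_addEdge_last i
      rw [neighbors_addEdge_last, Finset.sum_singleton, degree_addEdge_last, if_neg (by omega),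
        loopNeighbors_addEdge_last G i hi, degree_addEdge_of_lt G i hi, if_pos rfl]
      omega

end AttachmentGraph

/-! ### Expectations and the effect of one step -/

namespace AttachmentGraph

variable {n : ℕ}

/-- The normalizing factor in the attachment probabilities. -/
noncomputable def totalWeight (a : ℝ) (n : ℕ) : ℝ := (a + 1) * ((n : ℝ) + 1) - 1

theorem totalWeight_pos {a : ℝ} (ha : 0 < a) (n : ℕ) : 0 < totalWeight a n := by
  have hn : (0 : ℝ) ≤ n := Nat.cast_nonneg n
  unfold totalWeight
  nlinarith [mul_nonneg ha.le hn]

theorem totalWeight_succ (a : ℝ) (n : ℕ) :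
    totalWeight a (n + 1) = totalWeight a n + (1 + a) := by
  simp only [totalWeight, Nat.cast_add, Nat.cast_one]
  ring

/-- The expectation of `f` after `n` steps of the attachment process. -/
noncomputable def mean (a : ℝ) : (n : ℕ) → (AttachmentGraph n → ℝ) → ℝ
  | 0, f => f empty
  | n + 1, f => mean a n fun G => ∑ i, attachProb a G i * f (G.addEdge i)

theorem mean_congr {a : ℝ} {f g : AttachmentGraph n → ℝ} (h : ∀ G, G.Reachable → f G = g G) :
    mean a n f = mean a n g := by
  induction n with
  | zero => exact h _ .empty
  | succ n ih =>
    refine ih fun G hG => Finset.sum_congr rfl fun i _ => ?_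
    rw [h _ (.addEdge G i hG)]

theorem mean_add (a : ℝ) (f g : AttachmentGraph n → ℝ) :
    mean a n (fun G => f G + g G) = mean a n f + mean a n g := by
  induction n with
  | zero => rfl
  | succ n ih => simp only [mean, mul_add, Finset.sum_add_distrib, ih]

theorem mean_const_mul (a c : ℝ) (f : AttachmentGraph n → ℝ) :
    mean a n (fun G => c * f G) = c * mean a n f := by
  induction n with
  | zero => rfl
  | succ n ih => simp only [mean, mul_left_comm _ c, ← Finset.mul_sum, ih]

theorem mean_const {a : ℝ} (ha : 0 < a) (n : ℕ) (c : ℝ) : mean a n (fun _ => c) = c := by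
  induction n with
  | zero => rfl
  | succ n ih => simp only [mean, ← Finset.sum_mul, sum_attachProb ha, one_mul, ih]

theorem mean_mono {a : ℝ} (ha : 0 < a) {f g : AttachmentGraph n → ℝ}
    (h : ∀ G, G.Reachable → f G ≤ g G) : mean a n f ≤ mean a n g := by
  induction n with
  | zero => exact h _ .empty
  | succ n ih =>
    exact ih fun G hG => Finset.sum_le_sum fun i _ =>
      mul_le_mul_of_nonneg_left (h _ (.addEdge G i hG)) (attachProb_nonneg ha G i)

theorem edges_injective : Function.Injective (edges : AttachmentGraph n → Multiset (Sym2 ℕ)) := by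
  rintro ⟨_, _, _, _⟩ ⟨_, _, _, _⟩ h
  cases h
  rfl

instance : Countable (AttachmentGraph n) :=
  haveI : Countable (Sym2 ℕ) := Quotient.countable
  haveI : Countable (Multiset (Sym2 ℕ)) := Quotient.countable
  edges_injective.countable

/-- Graphs on `n` vertices form a countable type, so the integral is a sum, and for nonnegative `f`
the order of summation is free. Conditioning on the graph before the last step then gives the
recursion of `mean`. -/
theorem lintegral_buckleyOsthus {a : ℝ} (ha : 0 < a) (f : AttachmentGraph n → ℝ)
    (hf : ∀ G, 0 ≤ f G) :
    ∫⁻ G, ENNReal.ofReal (f G) ∂(buckleyOsthus a ha n).toMeasure =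
      ENNReal.ofReal (mean a n f) := by
  induction n with
  | zero => simp [buckleyOsthus, mean, PMF.toMeasure_pure]
  | succ n ih =>
    rw [mean, ← ih _ fun G => Finset.sum_nonneg fun i _ =>
      mul_nonneg (attachProb_nonneg ha G i) (hf _)]
    have hsing : ∀ (m : ℕ) (p : PMF (AttachmentGraph m)) (G : AttachmentGraph m),
        p.toMeasure {G} = p G := fun m p G => PMF.toMeasure_apply_singleton _ _ trivial
    simp only [MeasureTheory.lintegral_countable', hsing, buckleyOsthus, PMF.bind_apply,
      ← ENNReal.tsum_mul_left]
    rw [ENNReal.tsum_comm]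
    refine tsum_congr fun G => ?_
    simp only [mul_left_comm _ (buckleyOsthus a ha n G), ENNReal.tsum_mul_left]
    rw [mul_comm]
    congr 1
    simp only [PMF.map_apply, tsum_fintype, Finset.mul_sum, mul_ite, mul_zero]
    rw [Summable.tsum_finsetSum fun _ _ => ENNReal.summable,
      ENNReal.ofReal_sum_of_nonneg fun i _ => mul_nonneg (attachProb_nonneg ha G i) (hf _)]
    refine Finset.sum_congr rfl fun i _ => ?_
    rw [tsum_eq_single (G.addEdge i) fun b hb => if_neg hb, if_pos rfl,
      ENNReal.ofReal_mul (attachProb_nonneg ha G i), mul_comm]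
    rfl

theorem integral_buckleyOsthus {a : ℝ} (ha : 0 < a) (f : AttachmentGraph n → ℝ)
    (hf : ∀ G, 0 ≤ f G) : ∫ G, f G ∂(buckleyOsthus a ha n).toMeasure = mean a n f := by
  rw [MeasureTheory.integral_eq_lintegral_of_nonneg_ae (Filter.Eventually.of_forall hf)
    (measurable_from_top (f := f)).aestronglyMeasurable, lintegral_buckleyOsthus ha f hf,
    ENNReal.toReal_ofReal]
  have := mean_mono ha (f := fun _ : AttachmentGraph n => (0 : ℝ)) fun G _ => hf G
  rwa [mean_const ha] at this

open Classical in
/-- The number of vertices with degree `j` and with `f` loops. -/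
noncomputable def degreeCount (f j : ℕ) (G : AttachmentGraph n) : ℝ :=
  ∑ v ∈ Finset.range n, if G.loopIndicator v = f ∧ G.degree v = j then 1 else 0

open Classical in
/-- The number of vertices without a loop, with degree `l`, with second degree `k`, and with `f`
neighbors that have a loop. -/
noncomputable def secondDegreeCount (f l k : ℕ) (G : AttachmentGraph n) : ℝ :=
  ∑ t ∈ Finset.range n, if s(t, t) ∉ G.edges ∧ G.loopNeighbors t = f ∧ G.degree t = l ∧
    G.secondDegree t = k then 1 else 0

theorem Reachable.numVertices_eq {G : AttachmentGraph n} (hG : G.Reachable) (l k : ℕ) :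
    (G.numVertices l k : ℝ) = secondDegreeCount 0 l k G + secondDegreeCount 1 l k G := by
  classical
  rw [numVertices, secondDegreeCount, secondDegreeCount, ← Finset.sum_add_distrib,
    Finset.card_filter, Nat.cast_sum]
  refine Finset.sum_congr rfl fun t ht => ?_
  by_cases h : s(t, t) ∈ G.edges
  · simp [h]
  · have := hG.loopNeighbors_le_one (Finset.mem_range.1 ht) h
    interval_cases G.loopNeighbors t <;> simp [h]

theorem sum_attachProb_ite {a : ℝ} (ha : 0 < a) (G : AttachmentGraph n) (S : Finset ℕ)
    (hS : ∀ i ∈ S, i < n) (x : ℝ) :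
    totalWeight a n * ∑ i, attachProb a G i * (if (i : ℕ) ∈ S then x else 0) =
      x * ∑ i ∈ S, ((G.degree i : ℝ) - 1 + a) := by
  have hD : (a + 1) * ((n : ℝ) + 1) - 1 ≠ 0 := (totalWeight_pos ha n).ne'
  rw [Fin.sum_univ_castSucc]
  have hlast : ((Fin.last n : Fin (n + 1)) : ℕ) ∉ S := fun h => by
    have := hS _ h
    simp at this
  rw [if_neg hlast, mul_zero, add_zero, Finset.mul_sum]
  have h : ∀ i : Fin n, totalWeight a n * (attachProb a G i.castSucc *
      (if ((i.castSucc : Fin (n + 1)) : ℕ) ∈ S then x else 0)) =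
        if (i : ℕ) ∈ S then x * ((G.degree i : ℝ) - 1 + a) else 0 := by
    intro i
    simp only [attachProb, Fin.val_castSucc, i.2, if_true, totalWeight]
    split_ifs
    · field_simp
    · simp
  rw [Finset.sum_congr rfl fun i _ => h i,
    Fin.sum_univ_eq_sum_range (fun i => if i ∈ S then x * ((G.degree i : ℝ) - 1 + a) else 0) n,
    ← Finset.sum_filter, Finset.mul_sum]
  refine Finset.sum_congr ?_ fun _ _ => rfl
  ext i
  simp only [Finset.mem_filter, Finset.mem_range]
  exact ⟨fun h => h.2, fun h => ⟨hS i h, h⟩⟩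

theorem mul_sum_attachProb_const {a : ℝ} (ha : 0 < a) (G : AttachmentGraph n) (x : ℝ) :
    totalWeight a n * ∑ i, attachProb a G i * x = totalWeight a n * x := by
  rw [← Finset.sum_mul, sum_attachProb ha, one_mul]

/-- The effect of one step on a function of the degree of an old vertex. -/
theorem sum_attachProb_degree {a : ℝ} (ha : 0 < a) (G : AttachmentGraph n) {v : ℕ} (hv : v < n)
    (φ : ℕ → ℝ) :
    totalWeight a n * ∑ i, attachProb a G i * φ ((G.addEdge i).degree v) =
      ((G.degree v : ℝ) - 1 + a) * φ (G.degree v + 1) +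
        (totalWeight a n - ((G.degree v : ℝ) - 1 + a)) * φ (G.degree v) := by
  have h : ∀ i : Fin (n + 1), φ ((G.addEdge i).degree v) = φ (G.degree v) +
      if (i : ℕ) ∈ ({v} : Finset ℕ) then φ (G.degree v + 1) - φ (G.degree v) else 0 := by
    intro i
    simp only [degree_addEdge_of_lt G i hv, Finset.mem_singleton]
    split_ifs <;> simp
  simp only [h, mul_add, Finset.sum_add_distrib]
  rw [mul_sum_attachProb_const ha, sum_attachProb_ite ha G _ (by simpa using hv),
    Finset.sum_singleton]
  ring

/-- The effect of one step on a function of the degree and the second degree of an old vertex. -/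
theorem Reachable.sum_attachProb_secondDegree {a : ℝ} (ha : 0 < a) {G : AttachmentGraph n}
    (hG : G.Reachable) {t : ℕ} (ht : t < n) (hl : s(t, t) ∉ G.edges) (φ : ℕ → ℕ → ℝ) :
    totalWeight a n * ∑ i, attachProb a G i *
        φ ((G.addEdge i).degree t) ((G.addEdge i).secondDegree t) =
      ((G.degree t : ℝ) - 1 + a) * φ (G.degree t + 1) (G.secondDegree t) +
      (a * G.degree t + G.secondDegree t + G.loopNeighbors t) *
        φ (G.degree t) (G.secondDegree t + 1) +
      (totalWeight a n - ((G.degree t : ℝ) - 1 + a) -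
        (a * G.degree t + G.secondDegree t + G.loopNeighbors t)) *
        φ (G.degree t) (G.secondDegree t) := by
  classical
  have h : ∀ i : Fin (n + 1), φ ((G.addEdge i).degree t) ((G.addEdge i).secondDegree t) =
      φ (G.degree t) (G.secondDegree t) +
      (if (i : ℕ) ∈ ({t} : Finset ℕ) then
        φ (G.degree t + 1) (G.secondDegree t) - φ (G.degree t) (G.secondDegree t) else 0) +
      (if (i : ℕ) ∈ G.neighbors t then
        φ (G.degree t) (G.secondDegree t + 1) - φ (G.degree t) (G.secondDegree t) else 0) := by
    intro i
    simp only [degree_addEdge_of_lt G i ht, secondDegree_addEdge_of_lt G i ht hl,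
      Finset.mem_singleton, mem_neighbors]
    by_cases h1 : (i : ℕ) = t
    · simp [h1, hl]
    · by_cases h2 : s((i : ℕ), t) ∈ G.edges <;> simp [h1, h2]
  -- There are `G.degree t` neighbours, so the terms `-1` cancel the degree of `t` in the sum of the
  -- neighbouring degrees.
  have hsum : ∑ i ∈ G.neighbors t, ((G.degree i : ℝ) - 1 + a) =
      a * G.degree t + G.secondDegree t + G.loopNeighbors t := by
    have h1 := hG.sum_degree_neighbors ht hl
    have h2 : (∑ i ∈ G.neighbors t, (G.degree i : ℝ)) =
      G.degree t + G.secondDegree t + G.loopNeighbors t := by exact_mod_cast h1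
    rw [Finset.sum_add_distrib, Finset.sum_sub_distrib, h2]
    simp only [Finset.sum_const, hG.card_neighbors ht hl, nsmul_eq_mul]
    ring
  simp only [h, mul_add, Finset.sum_add_distrib]
  rw [mul_sum_attachProb_const ha, sum_attachProb_ite ha G _ (by simpa using ht),
    sum_attachProb_ite ha G _ fun i hi => G.lt_of_mem_neighbors hi, Finset.sum_singleton, hsum]
  ring

theorem sum_attachProb_mul_sum_range {a : ℝ} (G : AttachmentGraph n)
    (φ : (i : Fin (n + 1)) → ℕ → ℝ) :
    totalWeight a n * ∑ i, attachProb a G i * ∑ v ∈ Finset.range (n + 1), φ i v =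
      ∑ v ∈ Finset.range n, totalWeight a n * ∑ i, attachProb a G i * φ i v +
        totalWeight a n * ∑ i, attachProb a G i * φ i n := by
  simp only [Finset.sum_range_succ, mul_add, Finset.sum_add_distrib, Finset.mul_sum]
  rw [Finset.sum_comm]

/-- The last summand is the birth term: the new vertex has a loop and degree 2 with probability a/D,
and otherwise no loop and degree 1. -/
theorem sum_attachProb_degreeCount {a : ℝ} (ha : 0 < a) (G : AttachmentGraph n) (f j : ℕ) :
    totalWeight a n * ∑ i, attachProb a G i * degreeCount f (j + 1) (G.addEdge i) =
      (totalWeight a n - (j + a)) * degreeCount f (j + 1) G + (j - 1 + a) * degreeCount f j G +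
      ((if f = 0 ∧ j = 0 then totalWeight a n - a else 0) + if f = 1 ∧ j = 1 then a else 0) := by
  classical
  have hD := (totalWeight_pos ha n).ne'
  unfold degreeCount
  rw [sum_attachProb_mul_sum_range, Finset.mul_sum (Finset.range n),
    Finset.mul_sum (Finset.range n), ← Finset.sum_add_distrib]
  congr 1
  · refine Finset.sum_congr rfl fun v hv => ?_
    rw [Finset.mem_range] at hv
    have := sum_attachProb_degree ha G hv
      (fun d => if G.loopIndicator v = f ∧ d = j + 1 then (1 : ℝ) else 0)
    simp only [loopIndicator_addEdge_of_lt G _ hv] at this ⊢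
    rw [this]
    by_cases h1 : G.loopIndicator v = f
    · simp only [h1, true_and, add_left_inj]
      by_cases h2 : G.degree v = j
      · simp [h2]
      · by_cases h3 : G.degree v = j + 1
        · simp [h3]
        · simp [h2, h3]
    · simp [h1]
  · simp only [loopIndicator_addEdge_last, degree_addEdge_last]
    have hlast : totalWeight a n * attachProb a G (Fin.last n) = a := by
      simp only [attachProb, Fin.val_last, lt_irrefl, if_false]
      exact mul_div_cancel₀ _ hD
    have hsum := sum_attachProb ha G
    rw [Fin.sum_univ_castSucc] at hsum ⊢
    have hne : ∀ i : Fin n, ((i.castSucc : Fin (n + 1)) : ℕ) ≠ n := fun i => i.2.ne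
    simp only [hne, if_false, Fin.val_last, if_true, ← Finset.sum_mul]
    rw [mul_add, ← mul_assoc, ← mul_assoc, hlast, eq_sub_of_add_eq hsum, mul_sub, mul_one, hlast]
    have e1 : (0 = f ∧ 1 = j + 1) ↔ (f = 0 ∧ j = 0) := by omega
    have e2 : (1 = f ∧ 2 = j + 1) ↔ (f = 1 ∧ j = 1) := by omega
    simp only [e1, e2, mul_ite, mul_one, mul_zero]

/-- A loopless newborn has degree 1, hence the birth term only for `l = 0`. It has second degree `k
+ 1` when its target has degree `k + 1 + f`, the shift by `f` being the double count of the target's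
loop. -/
theorem Reachable.sum_attachProb_secondDegreeCount {a : ℝ} (ha : 0 < a) {G : AttachmentGraph n}
    (hG : G.Reachable) (f l k : ℕ) :
    totalWeight a n * ∑ i, attachProb a G i * secondDegreeCount f (l + 1) (k + 1) (G.addEdge i) =
      (totalWeight a n - (l + a + (a * (l + 1) + (k + 1) + f))) *
        secondDegreeCount f (l + 1) (k + 1) G +
      (l - 1 + a) * secondDegreeCount f l (k + 1) G +
      (a * (l + 1) + k + f) * secondDegreeCount f (l + 1) k G +
      (if l = 0 then (k + f + a) * degreeCount f (k + 1 + f) G else 0) := by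
  classical
  unfold secondDegreeCount
  rw [sum_attachProb_mul_sum_range, Finset.mul_sum (Finset.range n),
    Finset.mul_sum (Finset.range n), Finset.mul_sum (Finset.range n),
    ← Finset.sum_add_distrib, ← Finset.sum_add_distrib]
  congr 1
  · refine Finset.sum_congr rfl fun t ht => ?_
    rw [Finset.mem_range] at ht
    simp only [mk_mem_addEdge_of_lt G _ ht ht, loopNeighbors_addEdge_of_lt G _ ht]
    by_cases hl : s(t, t) ∈ G.edges
    · simp [hl]
    by_cases hf : G.loopNeighbors t = f
    swap
    · simp [hf]
    have := hG.sum_attachProb_secondDegree ha ht hl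
      (fun d e => if d = l + 1 ∧ e = k + 1 then (1 : ℝ) else 0)
    simp only [hl, hf, not_false_eq_true, true_and] at this ⊢
    rw [this]
    generalize G.degree t = d
    generalize G.secondDegree t = e
    simp only [add_left_inj]
    by_cases h1 : d = l
    · subst h1
      by_cases h2 : e = k + 1
      · simp [h2]
      · simp [h2]
    · by_cases h2 : d = l + 1
      · subst h2
        by_cases h3 : e = k + 1
        · subst h3
          simp
          ring
        · by_cases h4 : e = k
          · subst h4
            simp
          · simp [h3, h4]
      · simp [h1, h2]
  · have hS : ∀ i : Fin (n + 1), (if s(n, n) ∉ (G.addEdge i).edges ∧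
        (G.addEdge i).loopNeighbors n = f ∧ (G.addEdge i).degree n = l + 1 ∧
        (G.addEdge i).secondDegree n = k + 1 then (1 : ℝ) else 0) =
        if (i : ℕ) ∈ (Finset.range n).filter
          (fun i => G.loopIndicator i = f ∧ G.degree i = k + 1 + f) then
          (if l = 0 then 1 else 0) else 0 := by
      intro i
      simp only [mk_mem_addEdge_last, degree_addEdge_last]
      by_cases hi : (i : ℕ) = n
      · simp [hi]
      have hi' : (i : ℕ) < n := by omega
      have h1 := hG.secondDegree_addEdge_last i
      simp only [loopNeighbors_addEdge_last G i hi', if_neg hi, Finset.mem_filter,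
        Finset.mem_range, hi', true_and, ← ite_and]
      refine if_congr ?_ rfl rfl
      omega
    simp only [hS]
    rw [sum_attachProb_ite ha G _ (by simp +contextual)]
    by_cases hl : l = 0
    · rw [if_pos hl, if_pos hl, one_mul, degreeCount, ← Finset.sum_filter, Finset.mul_sum]
      refine Finset.sum_congr rfl fun i hi => ?_
      rw [(Finset.mem_filter.1 hi).2.2]
      push_cast
      ring
    · rw [if_neg hl, if_neg hl, zero_mul]

end AttachmentGraph

/-! ### Recurrences and size of the constants c(k) and c(l,k) -/

/-- (1-1/t)^p ≤ exp(-p/t) ≤ t/(t+p) = 1 - p/(t+p) ≤ 1 - p/R. This is what makes t^p a comparison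
function whenever denominator and loss rate differ by `p`. -/
theorem rpow_sub_one_mul_le {t p R : ℝ} (ht : 1 ≤ t) (hp : 0 ≤ p) (hR : t + p ≤ R) :
    (t - 1) ^ p * R ≤ t ^ p * (R - p) := by
  have ht0 : 0 < t := by linarith
  have htp : 0 < t + p := by linarith
  have h1 : (t - 1) / t ≤ Real.exp (-(1 / t)) := by
    have := Real.add_one_le_exp (-(1 / t))
    rw [sub_div, div_self ht0.ne']
    linarith
  have h2 : ((t - 1) / t) ^ p ≤ t / (t + p) := by
    calc ((t - 1) / t) ^ p ≤ Real.exp (-(1 / t)) ^ p :=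
          Real.rpow_le_rpow (div_nonneg (by linarith) ht0.le) h1 hp
      _ = (Real.exp (p / t))⁻¹ := by
          rw [← Real.exp_mul, ← Real.exp_neg]
          congr 1
          ring
      _ ≤ ((t + p) / t)⁻¹ := by
          refine inv_anti₀ (by positivity) ?_
          have := Real.add_one_le_exp (p / t)
          rw [add_div, div_self ht0.ne']
          linarith
      _ = t / (t + p) := inv_div _ _
  rw [Real.div_rpow (by linarith) ht0.le, div_le_iff₀ (by positivity)] at h2
  have h3 : t / (t + p) * R ≤ R - p := by
    rw [div_mul_eq_mul_div, div_le_iff₀ htp]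
    nlinarith
  calc (t - 1) ^ p * R ≤ t / (t + p) * t ^ p * R :=
        mul_le_mul_of_nonneg_right h2 (by linarith)
    _ = t ^ p * (t / (t + p) * R) := by ring
    _ ≤ _ := mul_le_mul_of_nonneg_left h3 (by positivity)

theorem degreeConst_one {a : ℝ} (ha : 0 < a) : degreeConst a 1 * (1 + 2 * a) = 1 + a := by
  have h1 : Real.Gamma (a + 2) = (a + 1) * Real.Gamma (a + 1) := by
    rw [← Real.Gamma_add_one (by positivity)]
    congr 1
    ring
  have h2 : Real.Gamma (a + (a + 2)) = (1 + 2 * a) * Real.Gamma (a + (a + 1)) := by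
    have := Real.Gamma_add_one (s := a + (a + 1)) (by positivity)
    rw [show a + (a + 2) = a + (a + 1) + 1 by ring, this]
    ring
  have g1 := (Real.Gamma_pos_of_pos ha).ne'
  have g2 := (Real.Gamma_pos_of_pos (show 0 < a + 1 by positivity)).ne'
  have g3 := (Real.Gamma_pos_of_pos (show 0 < a + (a + 1) by positivity)).ne'
  have h3 : (1 + 2 * a) ≠ 0 := by positivity
  simp only [degreeConst, ProbabilityTheory.beta, Nat.cast_one, sub_self, zero_add, h1, h2]
  field_simp
  ring

theorem degreeConst_succ {a : ℝ} (ha : 0 < a) (k : ℕ) :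
    degreeConst a (k + 2) * (k + 2 + 2 * a) = degreeConst a (k + 1) * (k + a) := by
  have hk : (0 : ℝ) ≤ k := Nat.cast_nonneg k
  have h1 : Real.Gamma (((k + 2 : ℕ) : ℝ) - 1 + a) = (k + a) * Real.Gamma (k + a) := by
    rw [← Real.Gamma_add_one (by positivity)]
    congr 1
    push_cast
    ring
  have h2 : Real.Gamma (((k + 2 : ℕ) : ℝ) - 1 + a + (a + 2)) =
      (k + 2 + 2 * a) * Real.Gamma (k + a + (a + 2)) := by
    have := Real.Gamma_add_one (s := k + a + (a + 2)) (by positivity)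
    rw [show ((k + 2 : ℕ) : ℝ) - 1 + a + (a + 2) = k + a + (a + 2) + 1 by push_cast; ring, this]
    ring
  have h3 : ((k + 1 : ℕ) : ℝ) - 1 + a = k + a := by push_cast; ring
  have g1 := (Real.Gamma_pos_of_pos (show 0 < k + a + (a + 2) by positivity)).ne'
  have g2 : (k + 2 + 2 * a) ≠ 0 := by positivity
  simp only [degreeConst, ProbabilityTheory.beta, h1, h2, h3]
  field_simp

theorem degreeConst_pos {a : ℝ} (ha : 0 < a) (k : ℕ) : 0 < degreeConst a (k + 1) := by
  have hk : (0 : ℝ) ≤ k := Nat.cast_nonneg k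
  refine div_pos (ProbabilityTheory.beta_pos ?_ (by positivity))
    (ProbabilityTheory.beta_pos ha (by positivity))
  push_cast
  linarith

/-- Equality holds at `k = 0`, and the recurrence makes the left side nonincreasing. Quadratic decay
is enough to control the main term for degrees too large to occur. -/
theorem degreeConst_mul_le {a : ℝ} (ha : 0 < a) (k : ℕ) :
    degreeConst a (k + 1) * ((k + a) * (k + 1 + 2 * a)) ≤ a * (1 + a) := by
  induction k with
  | zero =>
    have := degreeConst_one ha
    simp only [Nat.cast_zero, zero_add] at this ⊢
    refine le_of_eq ?_
    linear_combination a * this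
  | succ k ih =>
    have h := degreeConst_succ ha k
    have hk : (0 : ℝ) ≤ k := Nat.cast_nonneg k
    have hp := degreeConst_pos ha k
    push_cast
    calc degreeConst a (k + 2) * ((k + 1 + a) * (k + 1 + 1 + 2 * a))
        = degreeConst a (k + 1) * (k + a) * (k + 1 + a) := by
          rw [← h]
          ring
      _ ≤ degreeConst a (k + 1) * (k + a) * (k + 1 + 2 * a) :=
          mul_le_mul_of_nonneg_left (by linarith) (by positivity)
      _ ≤ _ := by
          rw [mul_assoc]
          exact ih

/-- The product on the right is nondecreasing in `k`, by `rpow_sub_one_mul_le` with exponent 2+a. -/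
theorem exists_le_degreeConst {a : ℝ} (ha : 0 < a) :
    ∃ c > 0, ∀ k : ℕ, c ≤ degreeConst a (k + 2) * ((k : ℝ) + a) ^ (2 + a) := by
  have hpos := degreeConst_pos ha 1
  refine ⟨degreeConst a 2 * a ^ (2 + a), by positivity, fun k => ?_⟩
  induction k with
  | zero => simp
  | succ k ih =>
    refine ih.trans ?_
    have hk : (0 : ℝ) ≤ k := Nat.cast_nonneg k
    have hp := degreeConst_pos ha (k + 1)
    have h := degreeConst_succ ha (k + 1)
    have hL := rpow_sub_one_mul_le (t := k + 1 + a) (p := 2 + a) (R := k + 1 + a + (2 + a))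
      (by linarith) (by linarith) le_rfl
    push_cast at h ⊢
    rw [show (k : ℝ) + 1 + a - 1 = k + a by ring, add_sub_cancel_right] at hL
    have hR : 0 < (k : ℝ) + 1 + a + (2 + a) := by positivity
    refine le_of_mul_le_mul_right ?_ hR
    calc degreeConst a (k + 2) * (k + a) ^ (2 + a) * (k + 1 + a + (2 + a))
        = degreeConst a (k + 2) * ((k + a) ^ (2 + a) * (k + 1 + a + (2 + a))) := by ring
      _ ≤ degreeConst a (k + 2) * ((k + 1 + a) ^ (2 + a) * (k + 1 + a)) :=
          mul_le_mul_of_nonneg_left hL hp.le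
      _ = _ := by
          linear_combination -(k + 1 + a : ℝ) ^ (2 + a) * h

theorem secondDegreeConst_zero_left (a : ℝ) (k : ℕ) : secondDegreeConst a 0 k = 0 := by
  rw [secondDegreeConst, if_pos (Or.inl rfl)]

theorem secondDegreeConst_zero_right (a : ℝ) (l : ℕ) : secondDegreeConst a l 0 = 0 := by
  rw [secondDegreeConst, if_pos (Or.inr rfl)]

theorem secondDegreeConst_one {a : ℝ} (ha : 0 < a) (k : ℕ) :
    secondDegreeConst a 1 (k + 1) * (k + 2 + 3 * a) =
      (secondDegreeConst a 1 k + degreeConst a (k + 1)) * (k + a) := by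
  have hk : (0 : ℝ) ≤ k := Nat.cast_nonneg k
  have h : (k : ℝ) + 2 + 3 * a ≠ 0 := by positivity
  rw [secondDegreeConst, if_neg (by omega), if_pos rfl, Nat.add_sub_cancel]
  push_cast
  rw [show (k : ℝ) + 1 + 3 * a + 1 = k + 2 + 3 * a by ring]
  field_simp
  ring

theorem secondDegreeConst_succ {a : ℝ} (ha : 0 < a) (l k : ℕ) :
    secondDegreeConst a (l + 2) (k + 1) * ((l + 2) * (1 + a) + (k + 1) + 2 * a) =
      secondDegreeConst a (l + 2) k * (a * (l + 2) + k) +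
        secondDegreeConst a (l + 1) (k + 1) * (l + a) := by
  have hk : (0 : ℝ) ≤ k := Nat.cast_nonneg k
  have hl : (0 : ℝ) ≤ l := Nat.cast_nonneg l
  have h : ((l : ℝ) + 2) * (1 + a) + (k + 1) + 2 * a ≠ 0 := by positivity
  rw [secondDegreeConst, if_neg (by omega), if_neg (by omega), Nat.add_sub_cancel]
  rw [show l + 2 - 1 = l + 1 by omega]
  push_cast
  field_simp
  ring

theorem secondDegreeConst_pos {a : ℝ} (ha : 0 < a) (l k : ℕ) :
    0 < secondDegreeConst a (l + 1) (k + 1) := by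
  have hnn : ∀ l, (∀ k, 0 < secondDegreeConst a (l + 1) (k + 1)) →
      ∀ k, 0 ≤ secondDegreeConst a (l + 1) k := by
    rintro l h (_ | k)
    · rw [secondDegreeConst_zero_right]
    · exact (h k).le
  induction l generalizing k with
  | zero =>
    induction k with
    | zero =>
      have h := secondDegreeConst_one ha 0
      rw [secondDegreeConst_zero_right] at h
      have hp := degreeConst_pos ha 0
      have h0 : ((0 : ℕ) : ℝ) = 0 := Nat.cast_zero
      rw [h0] at h
      refine pos_of_mul_pos_left (b := 0 + 2 + 3 * a) ?_ (by positivity)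
      rw [zero_add, h]
      positivity
    | succ k ih =>
      have h := secondDegreeConst_one ha (k + 1)
      have hp := degreeConst_pos ha (k + 1)
      refine pos_of_mul_pos_left (b := ((k + 1 : ℕ) : ℝ) + 2 + 3 * a) ?_ (by positivity)
      rw [zero_add] at ih
      rw [zero_add, h]
      positivity
  | succ l ih =>
    induction k with
    | zero =>
      have h := secondDegreeConst_succ ha l 0
      rw [secondDegreeConst_zero_right] at h
      refine pos_of_mul_pos_left
        (b := (l + 2) * (1 + a) + (((0 : ℕ) : ℝ) + 1) + 2 * a) ?_ (by positivity)
      rw [h]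
      have := ih 0
      positivity
    | succ k ih' =>
      have h := secondDegreeConst_succ ha l (k + 1)
      refine pos_of_mul_pos_left
        (b := (l + 2) * (1 + a) + (((k + 1 : ℕ) : ℝ) + 1) + 2 * a) ?_ (by positivity)
      rw [h]
      have := ih (k + 1)
      positivity

theorem secondDegreeConst_nonneg {a : ℝ} (ha : 0 < a) (l k : ℕ) : 0 ≤ secondDegreeConst a l k := by
  rcases l with _ | l
  · rw [secondDegreeConst_zero_left]
  rcases k with _ | k
  · rw [secondDegreeConst_zero_right]
  exact (secondDegreeConst_pos ha l k).le

theorem secondDegreeConst_one_mul_le {a : ℝ} (ha : 0 < a) (k : ℕ) :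
    secondDegreeConst a 1 k * (k + a) ≤ 1 + a := by
  induction k with
  | zero =>
    rw [secondDegreeConst_zero_right, zero_mul]
    positivity
  | succ k ih =>
    have hk : (0 : ℝ) ≤ k := Nat.cast_nonneg k
    have h := secondDegreeConst_one ha k
    have h1 := degreeConst_mul_le ha k
    have h2 : degreeConst a (k + 1) * (k + a) * (k + 1 + a) ≤ a * (1 + a) := by
      refine le_trans ?_ h1
      rw [← mul_assoc]
      have := degreeConst_pos ha k
      exact mul_le_mul_of_nonneg_left (by linarith) (by positivity)
    push_cast
    refine le_of_mul_le_mul_right ?_ (show 0 < (k : ℝ) + 2 + 3 * a by positivity)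
    calc secondDegreeConst a 1 (k + 1) * (k + 1 + a) * (k + 2 + 3 * a)
        = secondDegreeConst a 1 k * (k + a) * (k + 1 + a) +
          degreeConst a (k + 1) * (k + a) * (k + 1 + a) := by
          linear_combination (k + 1 + a) * h
      _ ≤ (1 + a) * (k + 1 + a) + a * (1 + a) :=
          add_le_add (mul_le_mul_of_nonneg_right ih (by positivity)) h2
      _ ≤ _ := by nlinarith

/-- The order k^(-1-a) comes from the source term c(k). In the induction the denominator splits as
(k+1+a) + (2a+2): the inherited term pays for the first part and the source for the second. -/
theorem exists_le_secondDegreeConst_one {a : ℝ} (ha : 0 < a) :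
    ∃ c > 0, ∀ k : ℕ, c ≤ secondDegreeConst a 1 (k + 1) * ((k : ℝ) + 1) ^ (1 + a) := by
  obtain ⟨c₀, hc₀, h₀⟩ := exists_le_degreeConst ha
  have hpos := secondDegreeConst_pos ha 0 0
  rw [zero_add] at hpos
  set c₁ := min (c₀ / (2 * a + 2)) (secondDegreeConst a 1 1 * a ^ (1 + a))
  have hc₁pos : 0 < c₁ := lt_min (by positivity) (by positivity)
  have hc₁le : c₁ * (2 * a + 2) ≤ c₀ := by
    rw [← le_div_iff₀ (by positivity)]
    exact min_le_left _ _
  have key : ∀ k : ℕ, c₁ ≤ secondDegreeConst a 1 (k + 1) * ((k : ℝ) + a) ^ (1 + a) := by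
    intro k
    induction k with
    | zero =>
      simp only [Nat.cast_zero, zero_add]
      exact min_le_right _ _
    | succ k ih =>
      have hk : (0 : ℝ) ≤ k := Nat.cast_nonneg k
      have h := secondDegreeConst_one ha (k + 1)
      have hc := (secondDegreeConst_pos ha 0 k).le
      have hd := (degreeConst_pos ha (k + 1)).le
      rw [zero_add] at hc
      push_cast at h ⊢
      have hpow : ((k : ℝ) + 1 + a) ^ (2 + a) = (k + 1 + a) ^ (1 + a) * (k + 1 + a) := by
        rw [← Real.rpow_add_one (by positivity)]
        congr 1
        ring
      have e1 : c₁ ≤ secondDegreeConst a 1 (k + 1) * (k + 1 + a) ^ (1 + a) :=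
        ih.trans (mul_le_mul_of_nonneg_left
          (Real.rpow_le_rpow (by positivity) (by linarith) (by positivity)) hc)
      have e2 : c₀ ≤ degreeConst a (k + 2) * (k + 1 + a) ^ (2 + a) :=
        (h₀ k).trans (mul_le_mul_of_nonneg_left
          (Real.rpow_le_rpow (by positivity) (by linarith) (by positivity)) hd)
      refine le_of_mul_le_mul_right ?_ (show 0 < (k : ℝ) + 1 + 2 + 3 * a by positivity)
      calc c₁ * (k + 1 + 2 + 3 * a) = c₁ * (k + 1 + a) + c₁ * (2 * a + 2) := by ring
        _ ≤ secondDegreeConst a 1 (k + 1) * (k + 1 + a) ^ (1 + a) * (k + 1 + a) +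
            degreeConst a (k + 2) * (k + 1 + a) ^ (2 + a) :=
          add_le_add (mul_le_mul_of_nonneg_right e1 (by positivity)) (hc₁le.trans e2)
        _ = _ := by
          rw [hpow]
          linear_combination -(k + 1 + a : ℝ) ^ (1 + a) * h
  refine ⟨c₁ / (1 + a) ^ (1 + a), by positivity, fun k => ?_⟩
  have hk : (0 : ℝ) ≤ k := Nat.cast_nonneg k
  have hc := (secondDegreeConst_pos ha 0 k).le
  rw [zero_add] at hc
  rw [div_le_iff₀ (by positivity), mul_assoc, ← Real.mul_rpow (by positivity) (by positivity)]
  refine (key k).trans (mul_le_mul_of_nonneg_left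
    (Real.rpow_le_rpow (by positivity) ?_ (by positivity)) hc)
  nlinarith

/-! ### Expected counts, the comparison principle, and the case `l = 1` -/

namespace AttachmentGraph

variable {n : ℕ}

theorem totalWeight_eq (a : ℝ) (n : ℕ) : totalWeight a n = (1 + a) * n + a := by
  unfold totalWeight
  ring

theorem totalWeight_div_le {a : ℝ} (ha : 0 < a) (n : ℕ) :
    totalWeight a n / (1 + a) ≤ n + 1 ∧ totalWeight a n / (1 + a) ≤ n + a := by
  have h : (0 : ℝ) < 1 + a := by positivity
  rw [div_le_iff₀ h, div_le_iff₀ h, totalWeight_eq]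
  constructor <;> nlinarith

/-- The expected number of vertices with degree `j` and with `f` loops. -/
noncomputable def expectedDegreeCount (a : ℝ) (f n j : ℕ) : ℝ := mean a n (degreeCount f j)

/-- The expected number of vertices without a loop, with degree `l`, with second degree `k`, and
with `f` neighbors that have a loop. -/
noncomputable def expectedSecondDegreeCount (a : ℝ) (f n l k : ℕ) : ℝ :=
  mean a n (secondDegreeCount f l k)

theorem expectedNum_eq {a : ℝ} (ha : 0 < a) (n l k : ℕ) :
    expectedNum a ha n l k =
      expectedSecondDegreeCount a 0 n l k + expectedSecondDegreeCount a 1 n l k := by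
  rw [expectedNum, integral_buckleyOsthus ha _ fun G => Nat.cast_nonneg _,
    mean_congr fun G hG => hG.numVertices_eq l k, mean_add]
  rfl

theorem expectedDegreeCount_le {a : ℝ} (ha : 0 < a) (f n j : ℕ) :
    expectedDegreeCount a f n j ≤ n := by
  refine (mean_mono ha (g := fun _ => (n : ℝ)) fun G _ => ?_).trans_eq (mean_const ha n n)
  refine (Finset.sum_le_card_nsmul _ _ 1 fun v _ => ?_).trans_eq (by simp)
  split_ifs <;> norm_num

theorem expectedDegreeCount_eq_zero {a : ℝ} (ha : 0 < a) {f n j : ℕ} (h : j ≤ f ∨ n + f < j) :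
    expectedDegreeCount a f n j = 0 := by
  refine (mean_congr fun G hG => ?_).trans (mean_const ha n 0)
  refine Finset.sum_eq_zero fun v hv => if_neg ?_
  rintro ⟨rfl, rfl⟩
  rw [Finset.mem_range] at hv
  have h1 : 1 ≤ G.degree v := G.one_le_degree v hv
  have h2 := hG.degree_le v
  rcases h with h | h
  · unfold loopIndicator at h
    split_ifs at h with hl
    · have := hG.two_le_degree hl
      omega
    · omega
  · omega

theorem expectedSecondDegreeCount_eq_zero {a : ℝ} (ha : 0 < a) (f : ℕ) {n l k : ℕ}
    (h : l = 0 ∨ k = 0 ∨ n < l + k) : expectedSecondDegreeCount a f n l k = 0 := by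
  refine (mean_congr fun G hG => ?_).trans (mean_const ha n 0)
  refine Finset.sum_eq_zero fun v hv => if_neg ?_
  rintro ⟨hl, -, rfl, rfl⟩
  rw [Finset.mem_range] at hv
  have h1 : 1 ≤ G.degree v := G.one_le_degree v hv
  have h2 := hG.degree_add_secondDegree_le hl
  have h3 := hG.one_le_secondDegree hv hl
  omega

theorem expectedSecondDegreeCount_nonneg {a : ℝ} (ha : 0 < a) (f n l k : ℕ) :
    0 ≤ expectedSecondDegreeCount a f n l k := by
  refine (mean_const ha n 0).symm.trans_le (mean_mono ha fun G _ => ?_)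
  refine Finset.sum_nonneg fun v _ => ?_
  split_ifs <;> norm_num

theorem expectedDegreeCount_succ {a : ℝ} (ha : 0 < a) (f n j : ℕ) :
    totalWeight a n * expectedDegreeCount a f (n + 1) (j + 1) =
      (totalWeight a n - (j + a)) * expectedDegreeCount a f n (j + 1) +
        (j - 1 + a) * expectedDegreeCount a f n j +
        ((if f = 0 ∧ j = 0 then totalWeight a n - a else 0) + if f = 1 ∧ j = 1 then a else 0) := by
  simp only [expectedDegreeCount, mean]
  rw [← mean_const_mul, mean_congr fun G _ => sum_attachProb_degreeCount ha G f j, mean_add,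
    mean_add, mean_const ha, mean_const_mul, mean_const_mul]

theorem expectedSecondDegreeCount_succ {a : ℝ} (ha : 0 < a) (f n l k : ℕ) :
    totalWeight a n * expectedSecondDegreeCount a f (n + 1) (l + 1) (k + 1) =
      (totalWeight a n - (l + a + (a * (l + 1) + (k + 1) + f))) *
        expectedSecondDegreeCount a f n (l + 1) (k + 1) +
      (l - 1 + a) * expectedSecondDegreeCount a f n l (k + 1) +
      (a * (l + 1) + k + f) * expectedSecondDegreeCount a f n (l + 1) k +
      (if l = 0 then (k + f + a) * expectedDegreeCount a f n (k + 1 + f) else 0) := by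
  simp only [expectedSecondDegreeCount, expectedDegreeCount, mean]
  rw [← mean_const_mul, mean_congr fun G hG => hG.sum_attachProb_secondDegreeCount ha f l k,
    mean_add, mean_add, mean_add, mean_const_mul, mean_const_mul, mean_const_mul]
  congr 1
  split_ifs
  · rw [mean_const_mul]
  · rw [mean_const ha]

/-- Maximum principle: as D - r ≥ 0, the right side is at most (D-r)·b + r·b = D·b. -/
theorem le_of_recurrence {D r x x' y b σ : ℝ} (hD : 0 < D) (hr : r ≤ D)
    (h : D * x' ≤ (D - r) * x + y) (hx : x ≤ b) (hy : y ≤ σ) (hb : σ ≤ r * b) : x' ≤ b := by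
  refine le_of_mul_le_mul_left ?_ hD
  have := mul_le_mul_of_nonneg_left hx (sub_nonneg.2 hr)
  linarith

theorem abs_le_of_recurrence {D r x x' y b σ : ℝ} (hD : 0 < D) (hr : r ≤ D)
    (h : D * x' = (D - r) * x + y) (hx : |x| ≤ b) (hy : |y| ≤ σ) (hb : σ ≤ r * b) :
    |x'| ≤ b := by
  rw [abs_le'] at *
  refine ⟨le_of_recurrence hD hr h.le hx.1 hy.1 hb,
    le_of_recurrence (x := -x) (y := -y) hD hr (le_of_eq ?_) hx.2 hy.2 hb⟩
  linear_combination -h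

/-- With the factor `j + a`, which is the loss rate, a constant is preserved: the inflow is that
rate times the bounded quantity one degree lower. -/
theorem exists_expectedDegreeCount_loop_le {a : ℝ} (ha : 0 < a) :
    ∃ C > 0, ∀ n j : ℕ, (j + a) * expectedDegreeCount a 1 n (j + 1) ≤ C := by
  -- A looped vertex may have degree n+1, so the loss rate can be n+1+a; it is at most D once a·n ≥
  -- 1. Smaller `n` are bounded trivially.
  obtain ⟨N, hN⟩ := exists_nat_ge (1 / a)
  rw [div_le_iff₀ ha] at hN
  refine ⟨N * (N + a) + a, by positivity, fun n => ?_⟩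
  have hsmall : ∀ n ≤ N, ∀ j : ℕ,
      (j + a) * expectedDegreeCount a 1 n (j + 1) ≤ N * (N + a) + a := by
    intro n hn j
    rcases lt_or_ge (n + 1) (j + 1) with h | h
    · rw [expectedDegreeCount_eq_zero ha (Or.inr h), mul_zero]
      positivity
    · have h1 := expectedDegreeCount_le ha 1 n (j + 1)
      have h2 : (n : ℝ) ≤ N := by exact_mod_cast hn
      have h3 : (j : ℝ) ≤ N := by exact_mod_cast (by omega : j ≤ N)
      calc (j + a) * expectedDegreeCount a 1 n (j + 1) ≤ (j + a) * N :=
            mul_le_mul_of_nonneg_left (h1.trans h2) (by positivity)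
        _ ≤ (N + a) * N := mul_le_mul_of_nonneg_right (by linarith) (by positivity)
        _ ≤ _ := by linarith
  rcases le_total n N with hn | hn
  · exact hsmall n hn
  induction n, hn using Nat.le_induction with
  | base => exact hsmall N le_rfl
  | succ n hn ih =>
    intro j
    set C : ℝ := N * (N + a) + a with hC
    have hCa : a ≤ C := by
      have : (0 : ℝ) ≤ N * (N + a) := by positivity
      linarith
    rcases lt_or_ge (n + 1 + 1) (j + 1) with h | h
    · rw [expectedDegreeCount_eq_zero ha (Or.inr h), mul_zero]
      linarith
    have hjn : (j : ℝ) ≤ n + 1 := by exact_mod_cast (by omega : j ≤ n + 1)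
    have hNn : (N : ℝ) ≤ n := by exact_mod_cast hn
    have hr : (j : ℝ) + a ≤ totalWeight a n := by
      rw [totalWeight_eq]
      nlinarith
    have hrec := expectedDegreeCount_succ ha 1 n j
    have hy : (j - 1 + a) * expectedDegreeCount a 1 n j + (if j = 1 then a else 0) ≤ C := by
      rcases j with _ | _ | j
      · rw [expectedDegreeCount_eq_zero ha (Or.inl (by omega))]
        simp only [zero_ne_one, if_false]
        linarith
      · rw [expectedDegreeCount_eq_zero ha (Or.inl (by omega))]
        simpa using hCa
      · have := ih (j + 1)
        rw [if_neg (by omega)]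
        push_cast at this ⊢
        linarith
    refine le_of_recurrence (y := (j + a) * ((j - 1 + a) * expectedDegreeCount a 1 n j +
      (if j = 1 then a else 0))) (totalWeight_pos ha n) hr ?_ (ih j)
      (mul_le_mul_of_nonneg_left hy (by positivity)) le_rfl
    simp only [one_ne_zero, false_and, if_false, true_and, zero_add] at hrec
    refine le_of_eq ?_
    linear_combination (j + a) * hrec

/-- The same weight `j + a` works for the error. The main term solves the recurrence exactly, except
at degree 1. -/
theorem exists_abs_expectedDegreeCount_sub_le {a : ℝ} (ha : 0 < a) :
    ∃ C > 0, ∀ n j : ℕ, |(j + a) * (expectedDegreeCount a 0 n (j + 1) -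
      degreeConst a (j + 1) * (totalWeight a n / (1 + a)))| ≤ C := by
  have h1a : (1 + a) ≠ 0 := by positivity
  have hlarge : ∀ n j : ℕ, n < j + 1 → |(j + a) * (expectedDegreeCount a 0 n (j + 1) -
      degreeConst a (j + 1) * (totalWeight a n / (1 + a)))| ≤ a * (1 + a) + a := by
    intro n j h
    have hn : (n : ℝ) ≤ j := by exact_mod_cast (by omega : n ≤ j)
    have hD := totalWeight_pos ha n
    have hc := degreeConst_pos ha j
    have hb := (totalWeight_div_le ha n).1
    have hk : (0 : ℝ) ≤ j := Nat.cast_nonneg j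
    rw [expectedDegreeCount_eq_zero ha (Or.inr h), zero_sub, mul_neg, abs_neg,
      abs_of_nonneg (by positivity)]
    have := degreeConst_mul_le ha j
    calc (j + a) * (degreeConst a (j + 1) * (totalWeight a n / (1 + a)))
        = degreeConst a (j + 1) * ((j + a) * (totalWeight a n / (1 + a))) := by ring
      _ ≤ degreeConst a (j + 1) * ((j + a) * (j + 1 + 2 * a)) := by
          gcongr
          linarith
      _ ≤ _ := by linarith
  refine ⟨a * (1 + a) + a, by positivity, fun n => ?_⟩
  induction n with
  | zero => exact fun j => hlarge 0 j (by omega)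
  | succ n ih =>
    intro j
    rcases lt_or_ge (n + 1) (j + 1) with h | h
    · exact hlarge _ _ h
    have hjn : (j : ℝ) ≤ n := by exact_mod_cast (by omega : j ≤ n)
    have hn : (0 : ℝ) ≤ n := Nat.cast_nonneg n
    have hr : (j : ℝ) + a ≤ totalWeight a n := by
      rw [totalWeight_eq]
      nlinarith
    have hrec := expectedDegreeCount_succ ha 0 n j
    rw [totalWeight_succ, add_div, div_self h1a]
    rcases j with _ | j
    · refine abs_le_of_recurrence (y := a * -a) (σ := a * a) (totalWeight_pos ha n) hr ?_ (ih 0)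
        (by rw [mul_neg, abs_neg, abs_of_pos (by positivity)]) ?_
      · rw [expectedDegreeCount_eq_zero ha (j := 0) (Or.inl le_rfl)] at hrec
        have hc := degreeConst_one ha
        simp only [zero_add, Nat.cast_zero, true_and, if_true, zero_ne_one, false_and,
          if_false] at hrec ⊢
        field_simp
        linear_combination (1 + a) * hrec - totalWeight a n * hc
      · rw [Nat.cast_zero, zero_add]
        refine mul_le_mul_of_nonneg_left ?_ ha.le
        nlinarith
    · refine abs_le_of_recurrence (totalWeight_pos ha n) hr (y := ((j + 1 : ℕ) + a) *
        ((j + a) * (expectedDegreeCount a 0 n (j + 1) -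
          degreeConst a (j + 1) * (totalWeight a n / (1 + a))))) ?_ (ih (j + 1)) ?_ le_rfl
      · have hc := degreeConst_succ ha j
        simp only [Nat.add_eq_zero_iff, one_ne_zero, and_false, if_false, zero_ne_one,
          false_and, add_zero, Nat.cast_add, Nat.cast_one] at hrec ⊢
        field_simp
        linear_combination (1 + a) * hrec - totalWeight a n * hc
      · rw [abs_mul, abs_of_nonneg (by positivity)]
        exact mul_le_mul_of_nonneg_left (ih j) (by positivity)

theorem exists_expectedSecondDegreeCount_one_loop_le {a : ℝ} (ha : 0 < a) :
    ∃ C > 0, ∀ n k : ℕ, expectedSecondDegreeCount a 1 n 1 k ≤ C := by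
  obtain ⟨C, hC, hU⟩ := exists_expectedDegreeCount_loop_le ha
  refine ⟨C / a, by positivity, fun n => ?_⟩
  have hCa : 0 < C / a := by positivity
  induction n with
  | zero =>
    intro k
    rw [expectedSecondDegreeCount_eq_zero ha 1 (by omega)]
    exact hCa.le
  | succ n ih =>
    intro k
    rcases k with _ | k
    · rw [expectedSecondDegreeCount_eq_zero ha 1 (by omega)]
      exact hCa.le
    rcases lt_or_ge (n + 1) (1 + (k + 1)) with h | h
    · rw [expectedSecondDegreeCount_eq_zero ha 1 (by omega)]
      exact hCa.le
    have hkn : (k : ℝ) + 1 ≤ n := by exact_mod_cast (by omega : k + 1 ≤ n)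
    have hk : (0 : ℝ) ≤ k := Nat.cast_nonneg k
    have hrec := expectedSecondDegreeCount_succ ha 1 n 0 k
    rw [expectedSecondDegreeCount_eq_zero ha 1 (l := 0) (by omega)] at hrec
    have hT := expectedSecondDegreeCount_nonneg ha 1 n 1 (k + 1)
    -- The true loss rate is larger by one; dropping that unit only weakens the bound. With this
    -- `r`, the constant C/a gives equality of `σ` and r·C/a.
    refine le_of_recurrence (totalWeight_pos ha n) (r := 2 * a + k + 1)
      (y := (a + k + 1) * expectedSecondDegreeCount a 1 n 1 k +
        (k + 1 + a) * expectedDegreeCount a 1 n (k + 1 + 1))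
      (σ := (a + k + 1) * (C / a) + C) ?_ ?_ (ih (k + 1)) ?_ ?_
    · rw [totalWeight_eq]
      nlinarith
    · simp only [zero_add, Nat.cast_zero, Nat.cast_one, if_true, mul_zero, add_zero] at hrec
      rw [hrec]
      linarith
    · have := hU n (k + 1)
      push_cast at this
      exact add_le_add (mul_le_mul_of_nonneg_left (ih k) (by positivity)) this
    · have : C / a * a = C := div_mul_cancel₀ _ ha.ne'
      linarith

theorem abs_expectedSecondDegreeCount_sub_of_lt {a : ℝ} (ha : 0 < a) {n l k : ℕ}
    (h : n < l + k) : |expectedSecondDegreeCount a 0 n l k -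
      secondDegreeConst a l k * (totalWeight a n / (1 + a))| =
      secondDegreeConst a l k * (totalWeight a n / (1 + a)) := by
  have hD := totalWeight_pos ha n
  have hc := secondDegreeConst_nonneg ha l k
  rw [expectedSecondDegreeCount_eq_zero ha 0 (by omega), zero_sub, abs_neg,
    abs_of_nonneg (by positivity)]

/-- A constant is preserved: the loss rate exceeds the inflow rate from `k - 1` by 1+a, and the
source is the weighted degree error, which is bounded. -/
theorem exists_abs_expectedSecondDegreeCount_one_sub_le {a : ℝ} (ha : 0 < a) :
    ∃ C > 0, ∀ n k : ℕ, |expectedSecondDegreeCount a 0 n 1 k -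
      secondDegreeConst a 1 k * (totalWeight a n / (1 + a))| ≤ C := by
  obtain ⟨C, hC, hU⟩ := exists_abs_expectedDegreeCount_sub_le ha
  have h1a : (1 + a) ≠ 0 := by positivity
  have hlarge : ∀ n k : ℕ, n < 1 + k → |expectedSecondDegreeCount a 0 n 1 k -
      secondDegreeConst a 1 k * (totalWeight a n / (1 + a))| ≤ 1 + a + C := by
    intro n k h
    rw [abs_expectedSecondDegreeCount_sub_of_lt ha h]
    have h1 := secondDegreeConst_one_mul_le ha k
    have h2 := (totalWeight_div_le ha n).2
    have h3 : (n : ℝ) ≤ k := by exact_mod_cast (by omega : n ≤ k)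
    have h4 := mul_le_mul_of_nonneg_left (show totalWeight a n / (1 + a) ≤ k + a by linarith)
      (secondDegreeConst_nonneg ha 1 k)
    linarith
  refine ⟨1 + a + C, by positivity, fun n => ?_⟩
  induction n with
  | zero => exact fun k => hlarge 0 k (by omega)
  | succ n ih =>
    intro k
    rcases lt_or_ge (n + 1) (1 + k) with h | h
    · exact hlarge _ _ h
    rcases k with _ | k
    · rw [expectedSecondDegreeCount_eq_zero ha 0 (by omega), secondDegreeConst_zero_right,
        zero_mul, sub_zero, abs_zero]
      positivity
    have hkn : (k : ℝ) + 1 ≤ n := by exact_mod_cast (by omega : k + 1 ≤ n)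
    have hk : (0 : ℝ) ≤ k := Nat.cast_nonneg k
    have hrec := expectedSecondDegreeCount_succ ha 0 n 0 k
    rw [expectedSecondDegreeCount_eq_zero ha 0 (l := 0) (by omega)] at hrec
    have hc := secondDegreeConst_one ha k
    rw [totalWeight_succ, add_div, div_self h1a]
    refine abs_le_of_recurrence (totalWeight_pos ha n) (r := 2 * a + k + 1)
      (y := (a + k) * (expectedSecondDegreeCount a 0 n 1 k -
        secondDegreeConst a 1 k * (totalWeight a n / (1 + a))) +
        (k + a) * (expectedDegreeCount a 0 n (k + 1) -
          degreeConst a (k + 1) * (totalWeight a n / (1 + a))))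
      (σ := (a + k) * (1 + a + C) + C) ?_ ?_ (ih (k + 1)) ?_ ?_
    · rw [totalWeight_eq]
      nlinarith
    · simp only [zero_add, Nat.cast_zero, if_true, mul_zero, add_zero] at hrec
      field_simp
      linear_combination (1 + a) * hrec - totalWeight a n * hc
    · refine (abs_add_le _ _).trans (add_le_add ?_ (hU n k))
      rw [abs_mul, abs_of_nonneg (by positivity)]
      exact mul_le_mul_of_nonneg_left (ih k) (by positivity)
    · nlinarith

end AttachmentGraph

/-! ### Comparison functions for general `l` -/

namespace AttachmentGraph

theorem exists_abs_expectedSecondDegreeCount_sub_le {a : ℝ} (ha : 0 < a) :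
    ∃ C > 0, ∀ n l k : ℕ, |expectedSecondDegreeCount a 0 n (l + 1) k -
      secondDegreeConst a (l + 1) k * (totalWeight a n / (1 + a))| ≤
      C * (secondDegreeConst a (l + 1) k * ((l : ℝ) + k) ^ (1 + a)) := by
  obtain ⟨C₁, hC₁, h₁⟩ := exists_abs_expectedSecondDegreeCount_one_sub_le ha
  obtain ⟨c, hc, hlow⟩ := exists_le_secondDegreeConst_one ha
  have h1a : (1 + a) ≠ 0 := by positivity
  -- The first summand serves the case `l = 1`; the 2 serves empty classes, where the error is the
  -- main term alone.
  set C := C₁ / c + 2 with hC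
  have hCpos : 0 < C := by positivity
  have hzero : ∀ n l : ℕ, |expectedSecondDegreeCount a 0 n (l + 1) 0 -
      secondDegreeConst a (l + 1) 0 * (totalWeight a n / (1 + a))| ≤
      C * (secondDegreeConst a (l + 1) 0 * ((l : ℝ) + (0 : ℕ)) ^ (1 + a)) := by
    intro n l
    rw [expectedSecondDegreeCount_eq_zero ha 0 (by omega), secondDegreeConst_zero_right]
    simp
  have hone : ∀ n k : ℕ, |expectedSecondDegreeCount a 0 n (0 + 1) k -
      secondDegreeConst a (0 + 1) k * (totalWeight a n / (1 + a))| ≤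
      C * (secondDegreeConst a (0 + 1) k * (((0 : ℕ) : ℝ) + k) ^ (1 + a)) := by
    rintro n (_ | k)
    · exact hzero n 0
    refine (h₁ n (k + 1)).trans ?_
    have h := hlow k
    push_cast
    rw [zero_add]
    have hC₁' : C₁ = C₁ / c * c := (div_mul_cancel₀ _ hc.ne').symm
    rw [hC₁']
    exact mul_le_mul (by linarith) h hc.le hCpos.le
  have hlarge : ∀ n l k : ℕ, n < l + 2 + (k + 1) →
      |expectedSecondDegreeCount a 0 n (l + 2) (k + 1) -
        secondDegreeConst a (l + 2) (k + 1) * (totalWeight a n / (1 + a))| ≤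
        C * (secondDegreeConst a (l + 2) (k + 1) * ((l : ℝ) + k + 2) ^ (1 + a)) := by
    intro n l k h
    rw [abs_expectedSecondDegreeCount_sub_of_lt ha h]
    have h2 := (totalWeight_div_le ha n).1
    have h3 : (n : ℝ) ≤ l + k + 2 := by exact_mod_cast (by omega : n ≤ l + k + 2)
    have hl : (0 : ℝ) ≤ l := Nat.cast_nonneg l
    have hk : (0 : ℝ) ≤ k := Nat.cast_nonneg k
    have h4 : (l : ℝ) + k + 2 ≤ (l + k + 2) ^ (1 + a) :=
      Real.self_le_rpow_of_one_le (by linarith) (by linarith)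
    have hC2 : 2 ≤ C := by
      have : 0 ≤ C₁ / c := by positivity
      linarith
    rw [mul_left_comm]
    refine mul_le_mul_of_nonneg_left ?_ (secondDegreeConst_nonneg ha _ _)
    calc totalWeight a n / (1 + a) ≤ 2 * (l + k + 2) := by linarith
      _ ≤ _ := mul_le_mul hC2 h4 (by positivity) hCpos.le
  refine ⟨C, hCpos, fun n => ?_⟩
  induction n with
  | zero =>
    rintro (_ | l) (_ | k)
    · exact hzero 0 0
    · exact hone 0 (k + 1)
    · exact hzero 0 (l + 1)
    · convert hlarge 0 l k (by omega) using 4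
      push_cast
      ring
  | succ n ih =>
    rintro (_ | l) (_ | k)
    · exact hzero _ 0
    · exact hone _ (k + 1)
    · exact hzero _ (l + 1)
    have hcast : ((l + 1 : ℕ) : ℝ) + (k + 1 : ℕ) = l + k + 2 := by push_cast; ring
    rcases lt_or_ge (n + 1) (l + 2 + (k + 1)) with h | h
    · rw [hcast]
      exact hlarge _ _ _ h
    have hn : (l : ℝ) + k + 2 ≤ n := by exact_mod_cast (by omega : l + k + 2 ≤ n)
    have hl : (0 : ℝ) ≤ l := Nat.cast_nonneg l
    have hk : (0 : ℝ) ≤ k := Nat.cast_nonneg k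
    have hrec := expectedSecondDegreeCount_succ ha 0 n (l + 1) k
    have hc := secondDegreeConst_succ ha l k
    have ih1 := ih l (k + 1)
    have ih2 := ih (l + 1) k
    -- `R` is the denominator in the recurrence of c(l,k), and R - (1+a) is the loss rate.
    have hL := rpow_sub_one_mul_le (t := l + k + 2) (p := 1 + a)
      (R := (l + 2) * (1 + a) + (k + 1) + 2 * a) (by linarith) (by linarith) (by nlinarith)
    rw [show (l : ℝ) + k + 2 - 1 = l + k + 1 by ring] at hL
    rw [totalWeight_succ, add_div, div_self h1a]
    refine abs_le_of_recurrence (totalWeight_pos ha n)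
      (r := (l + 2) * (1 + a) + (k + 1) + 2 * a - (1 + a))
      (y := (l + a) * (expectedSecondDegreeCount a 0 n (l + 1) (k + 1) -
        secondDegreeConst a (l + 1) (k + 1) * (totalWeight a n / (1 + a))) +
        (a * (l + 2) + k) * (expectedSecondDegreeCount a 0 n (l + 1 + 1) k -
        secondDegreeConst a (l + 1 + 1) k * (totalWeight a n / (1 + a))))
      (σ := (l + a) * (C * (secondDegreeConst a (l + 1) (k + 1) * (l + k + 1) ^ (1 + a))) +
        (a * (l + 2) + k) * (C * (secondDegreeConst a (l + 2) k * (l + k + 1) ^ (1 + a))))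
      ?_ ?_ (ih (l + 1) (k + 1)) ?_ ?_
    · rw [totalWeight_eq]
      nlinarith
    · rw [if_neg (by omega)] at hrec
      push_cast at hrec
      field_simp
      linear_combination (1 + a) * hrec - totalWeight a n * hc
    · refine (abs_add_le _ _).trans (add_le_add ?_ ?_)
      · rw [abs_mul, abs_of_nonneg (by positivity)]
        refine mul_le_mul_of_nonneg_left (ih1.trans_eq ?_) (by positivity)
        push_cast
        ring_nf
      · rw [abs_mul, abs_of_nonneg (by positivity)]
        refine mul_le_mul_of_nonneg_left (ih2.trans_eq ?_) (by positivity)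
        push_cast
        ring_nf
    · rw [hcast]
      have hpos := secondDegreeConst_nonneg ha (l + 2) (k + 1)
      calc _ = C * secondDegreeConst a (l + 2) (k + 1) * ((l + k + 1) ^ (1 + a) *
            ((l + 2) * (1 + a) + (k + 1) + 2 * a)) := by
            linear_combination -C * ((l : ℝ) + k + 1) ^ (1 + a) * hc
        _ ≤ C * secondDegreeConst a (l + 2) (k + 1) * ((l + k + 2) ^ (1 + a) *
            ((l + 2) * (1 + a) + (k + 1) + 2 * a - (1 + a))) :=
            mul_le_mul_of_nonneg_left hL (by positivity)
        _ = _ := by ring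

/-- A preliminary bound, too weak by a factor of order `k`, but valid without a lower bound on a·k;
it is needed only for bounded `k`. The factor `a + k` compensates the faster growth of the second
degree. -/
theorem exists_expectedSecondDegreeCount_loop_le_rpow {a : ℝ} (ha : 0 < a) :
    ∃ C > 0, ∀ n l k : ℕ, expectedSecondDegreeCount a 1 n (l + 1) k ≤
      C * (secondDegreeConst a (l + 1) k * ((a + k) * ((l : ℝ) + k) ^ (1 + a))) := by
  obtain ⟨C₁, hC₁, h₁⟩ := exists_expectedSecondDegreeCount_one_loop_le ha
  obtain ⟨c, hc, hlow⟩ := exists_le_secondDegreeConst_one ha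
  set C := C₁ / c with hC
  have hCpos : 0 < C := by positivity
  refine ⟨C, hCpos, fun n => ?_⟩
  have hzero : ∀ n l k : ℕ, k = 0 ∨ n < l + 1 + k → expectedSecondDegreeCount a 1 n (l + 1) k ≤
      C * (secondDegreeConst a (l + 1) k * ((a + k) * ((l : ℝ) + k) ^ (1 + a))) := by
    intro n l k h
    rw [expectedSecondDegreeCount_eq_zero ha 1 (Or.inr h)]
    have := secondDegreeConst_nonneg ha (l + 1) k
    positivity
  induction n with
  | zero => exact fun l k => hzero 0 l k (by omega)
  | succ n ih =>
    rintro l (_ | k)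
    · exact hzero _ _ _ (Or.inl rfl)
    rcases l with _ | l
    · refine (h₁ _ (k + 1)).trans ?_
      have h := hlow k
      have hk : (0 : ℝ) ≤ k := Nat.cast_nonneg k
      have hC₁' : C₁ = C * c := (div_mul_cancel₀ _ hc.ne').symm
      rw [hC₁']
      refine mul_le_mul_of_nonneg_left (h.trans ?_) hCpos.le
      have hp := secondDegreeConst_nonneg ha 1 (k + 1)
      push_cast
      rw [zero_add]
      refine mul_le_mul_of_nonneg_left ?_ hp
      exact le_mul_of_one_le_left (by positivity) (by linarith)
    have hcast : ((l + 1 : ℕ) : ℝ) + (k + 1 : ℕ) = l + k + 2 := by push_cast; ring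
    rcases lt_or_ge (n + 1) (l + 2 + (k + 1)) with h | h
    · exact hzero _ _ _ (Or.inr h)
    have hn : (l : ℝ) + k + 2 ≤ n := by exact_mod_cast (by omega : l + k + 2 ≤ n)
    have hl : (0 : ℝ) ≤ l := Nat.cast_nonneg l
    have hk : (0 : ℝ) ≤ k := Nat.cast_nonneg k
    have hrec := expectedSecondDegreeCount_succ ha 1 n (l + 1) k
    have hc := secondDegreeConst_succ ha l k
    have ih1 := ih l (k + 1)
    have ih2 := ih (l + 1) k
    have hT := expectedSecondDegreeCount_nonneg ha 1 n (l + 1 + 1) (k + 1)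
    have hL := rpow_sub_one_mul_le (t := l + k + 2) (p := 1 + a)
      (R := (l + 2) * (1 + a) + (k + 1) + 2 * a) (by linarith) (by linarith) (by nlinarith)
    rw [show (l : ℝ) + k + 2 - 1 = l + k + 1 by ring] at hL
    have hpos := secondDegreeConst_nonneg ha (l + 2) (k + 1)
    have hpos' := secondDegreeConst_nonneg ha (l + 2) k
    -- The true loss rate is `r + 1`; the extra unit is given up so that r ≤ D holds for every `k`.
    refine le_of_recurrence (totalWeight_pos ha n)
      (r := (l + 2) * (1 + a) + (k + 1) + 2 * a - (1 + a))
      (y := (l + a) * expectedSecondDegreeCount a 1 n (l + 1) (k + 1) +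
        (a * (l + 2) + k + 1) * expectedSecondDegreeCount a 1 n (l + 1 + 1) k)
      (σ := (l + a) * (C * (secondDegreeConst a (l + 1) (k + 1) *
          ((a + (k + 1)) * (l + k + 1) ^ (1 + a)))) +
        (a * (l + 2) + k + 1) * (C * (secondDegreeConst a (l + 2) k *
          ((a + k) * (l + k + 1) ^ (1 + a)))))
      ?_ ?_ (ih (l + 1) (k + 1)) ?_ ?_
    · rw [totalWeight_eq]
      nlinarith
    · rw [if_neg (by omega)] at hrec
      push_cast at hrec
      rw [hrec]
      linarith
    · refine add_le_add ?_ ?_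
      · refine mul_le_mul_of_nonneg_left (ih1.trans_eq ?_) (by positivity)
        push_cast
        ring_nf
      · refine mul_le_mul_of_nonneg_left (ih2.trans_eq ?_) (by positivity)
        push_cast
        ring_nf
    · rw [hcast]
      have hswap : (a * (l + 2) + k + 1) * (a + k) ≤ (a * (l + 2) + k) * (a + (k + 1)) := by
        nlinarith
      calc _ = C * (l + k + 1) ^ (1 + a) * ((a + (k + 1)) *
            (secondDegreeConst a (l + 1) (k + 1) * (l + a)) +
            secondDegreeConst a (l + 2) k * ((a * (l + 2) + k + 1) * (a + k))) := by ring
        _ ≤ C * (l + k + 1) ^ (1 + a) * ((a + (k + 1)) *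
            (secondDegreeConst a (l + 1) (k + 1) * (l + a)) +
            secondDegreeConst a (l + 2) k * ((a * (l + 2) + k) * (a + (k + 1)))) := by gcongr
        _ = C * secondDegreeConst a (l + 2) (k + 1) * (a + (k + 1)) * ((l + k + 1) ^ (1 + a) *
            ((l + 2) * (1 + a) + (k + 1) + 2 * a)) := by
            linear_combination -C * ((l : ℝ) + k + 1) ^ (1 + a) * (a + (k + 1)) * hc
        _ ≤ C * secondDegreeConst a (l + 2) (k + 1) * (a + (k + 1)) * ((l + k + 2) ^ (1 + a) *
            ((l + 2) * (1 + a) + (k + 1) + 2 * a - (1 + a))) :=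
            mul_le_mul_of_nonneg_left hL (by positivity)
        _ = _ := by push_cast; ring

/-- With h(l,k) = al+k, the inflow rate from `k - 1` is h(l,k) instead of h(l,k)-1 = h(l,k-1), so
rate times weight is h(l,k)·h(l,k-1): exactly h(l,k) times the term in the recurrence of c(l,k). The
full loss rate is R - a, whence the exponent `a`. -/
theorem exists_expectedSecondDegreeCount_loop_le {a : ℝ} (ha : 0 < a) :
    ∃ C > 0, ∀ n l k : ℕ, expectedSecondDegreeCount a 1 n (l + 1) k ≤
      C * (secondDegreeConst a (l + 1) k * ((a * (l + 1) + k) * ((l : ℝ) + k) ^ a)) := by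
  obtain ⟨C₁, hC₁, h₁⟩ := exists_expectedSecondDegreeCount_one_loop_le ha
  obtain ⟨C₂, hC₂, h₂⟩ := exists_expectedSecondDegreeCount_loop_le_rpow ha
  obtain ⟨c, hc, hlow⟩ := exists_le_secondDegreeConst_one ha
  set C := C₁ / c + C₂ * ((1 + a + 1 / a) * (1 + 1 / a)) with hC
  have hCpos : 0 < C := by positivity
  refine ⟨C, hCpos, fun n => ?_⟩
  have hzero : ∀ n l k : ℕ, k = 0 ∨ n < l + 1 + k → expectedSecondDegreeCount a 1 n (l + 1) k ≤
      C * (secondDegreeConst a (l + 1) k * ((a * (l + 1) + k) * ((l : ℝ) + k) ^ a)) := by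
    intro n l k h
    rw [expectedSecondDegreeCount_eq_zero ha 1 (Or.inr h)]
    have := secondDegreeConst_nonneg ha (l + 1) k
    positivity
  induction n with
  | zero => exact fun l k => hzero 0 l k (by omega)
  | succ n ih =>
    rintro l (_ | k)
    · exact hzero _ _ _ (Or.inl rfl)
    have hk : (0 : ℝ) ≤ k := Nat.cast_nonneg k
    rcases l with _ | l
    · refine (h₁ _ (k + 1)).trans ?_
      have h := hlow k
      have hC₁' : C₁ = C₁ / c * c := (div_mul_cancel₀ _ hc.ne').symm
      rw [hC₁']
      have hCC : C₁ / c ≤ C := by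
        have : 0 ≤ C₂ * ((1 + a + 1 / a) * (1 + 1 / a)) := by positivity
        linarith
      refine mul_le_mul hCC (h.trans ?_) hc.le hCpos.le
      have hp := secondDegreeConst_nonneg ha 1 (k + 1)
      push_cast
      rw [zero_add, zero_add, mul_one, add_comm 1 a, Real.rpow_add_one (by positivity),
        mul_comm _ ((k : ℝ) + 1)]
      refine mul_le_mul_of_nonneg_left ?_ hp
      exact mul_le_mul_of_nonneg_right (by linarith) (by positivity)
    have hl : (0 : ℝ) ≤ l := Nat.cast_nonneg l
    have hcast : ((l + 1 : ℕ) : ℝ) + (k + 1 : ℕ) = l + k + 2 := by push_cast; ring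
    have hpos := secondDegreeConst_nonneg ha (l + 2) (k + 1)
    -- For a·k ≥ 1 the full loss rate is at most D. Otherwise `k` is bounded by 1/a, and the
    -- preliminary bound suffices.
    rcases lt_or_ge (a * k) 1 with hak | hak
    · refine (h₂ _ (l + 1) (k + 1)).trans ?_
      rw [hcast, add_comm 1 a, Real.rpow_add_one (by positivity)]
      push_cast
      have hka : (k : ℝ) ≤ 1 / a := by
        rw [le_div_iff₀ ha]
        linarith
      have e1 : a + ((k : ℝ) + 1) ≤ 1 + a + 1 / a := by linarith
      have e2 : (l : ℝ) + k + 2 ≤ (1 + 1 / a) * (a * (l + 1 + 1) + (k + 1)) := by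
        have h0 : (0 : ℝ) < 1 / a := by positivity
        have h1 : 1 / a * a = 1 := div_mul_cancel₀ _ ha.ne'
        have h2 : (1 + 1 / a) * (a * (l + 1 + 1) + (k + 1)) =
            a * (l + 2) + (k + 1) + (l + 2) + 1 / a * (k + 1) := by
          linear_combination ((l : ℝ) + 2) * h1
        rw [h2]
        have : 0 ≤ a * ((l : ℝ) + 2) + 1 / a * (k + 1) := by positivity
        linarith
      have hCC : C₂ * ((1 + a + 1 / a) * (1 + 1 / a)) ≤ C := by
        have : 0 ≤ C₁ / c := by positivity
        linarith
      calc C₂ * (secondDegreeConst a (l + 1 + 1) (k + 1) *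
            ((a + (k + 1)) * ((l + k + 2) ^ a * (l + k + 2))))
          = C₂ * secondDegreeConst a (l + 2) (k + 1) * (l + k + 2) ^ a *
            ((a + (k + 1)) * (l + k + 2)) := by ring
        _ ≤ C₂ * secondDegreeConst a (l + 2) (k + 1) * (l + k + 2) ^ a *
            ((1 + a + 1 / a) * ((1 + 1 / a) * (a * (l + 1 + 1) + (k + 1)))) := by
            refine mul_le_mul_of_nonneg_left ?_ (by positivity)
            exact mul_le_mul e1 e2 (by positivity) (by positivity)
        _ = C₂ * ((1 + a + 1 / a) * (1 + 1 / a)) * (secondDegreeConst a (l + 2) (k + 1) *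
            ((a * (l + 1 + 1) + (k + 1)) * (l + k + 2) ^ a)) := by ring
        _ ≤ _ := mul_le_mul_of_nonneg_right hCC (by positivity)
    rcases lt_or_ge (n + 1) (l + 2 + (k + 1)) with h | h
    · exact hzero _ _ _ (Or.inr h)
    have hn : (l : ℝ) + k + 2 ≤ n := by exact_mod_cast (by omega : l + k + 2 ≤ n)
    have hrec := expectedSecondDegreeCount_succ ha 1 n (l + 1) k
    have hc := secondDegreeConst_succ ha l k
    have ih1 := ih l (k + 1)
    have ih2 := ih (l + 1) k
    have hL := rpow_sub_one_mul_le (t := l + k + 2) (p := a)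
      (R := (l + 2) * (1 + a) + (k + 1) + 2 * a) (by linarith) ha.le (by nlinarith)
    rw [show (l : ℝ) + k + 2 - 1 = l + k + 1 by ring] at hL
    have hpos' := secondDegreeConst_nonneg ha (l + 1) (k + 1)
    refine le_of_recurrence (totalWeight_pos ha n)
      (r := (l + 2) * (1 + a) + (k + 1) + 2 * a - a)
      (y := (l + a) * expectedSecondDegreeCount a 1 n (l + 1) (k + 1) +
        (a * (l + 2) + k + 1) * expectedSecondDegreeCount a 1 n (l + 1 + 1) k)
      (σ := (l + a) * (C * (secondDegreeConst a (l + 1) (k + 1) *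
          ((a * (l + 1) + (k + 1)) * (l + k + 1) ^ a))) +
        (a * (l + 2) + k + 1) * (C * (secondDegreeConst a (l + 2) k *
          ((a * (l + 2) + k) * (l + k + 1) ^ a))))
      ?_ ?_ (ih (l + 1) (k + 1)) ?_ ?_
    · rw [totalWeight_eq]
      nlinarith
    · rw [if_neg (by omega)] at hrec
      push_cast at hrec
      refine le_of_eq ?_
      linear_combination hrec
    · refine add_le_add ?_ ?_
      · refine mul_le_mul_of_nonneg_left (ih1.trans_eq ?_) (by positivity)
        push_cast
        ring_nf
      · refine mul_le_mul_of_nonneg_left (ih2.trans_eq ?_) (by positivity)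
        push_cast
        ring_nf
    · rw [hcast]
      have hmono : a * ((l : ℝ) + 1) + (k + 1) ≤ a * (l + 2) + k + 1 := by linarith
      calc _ = C * (l + k + 1) ^ a * ((a * (l + 1) + (k + 1)) *
            (secondDegreeConst a (l + 1) (k + 1) * (l + a)) + (a * (l + 2) + k + 1) *
            (secondDegreeConst a (l + 2) k * (a * (l + 2) + k))) := by ring
        _ ≤ C * (l + k + 1) ^ a * ((a * (l + 2) + k + 1) *
            (secondDegreeConst a (l + 1) (k + 1) * (l + a)) + (a * (l + 2) + k + 1) *
            (secondDegreeConst a (l + 2) k * (a * (l + 2) + k))) := by gcongr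
        _ = C * secondDegreeConst a (l + 2) (k + 1) * (a * (l + 2) + k + 1) *
            ((l + k + 1) ^ a * ((l + 2) * (1 + a) + (k + 1) + 2 * a)) := by
            linear_combination -C * ((l : ℝ) + k + 1) ^ a * (a * (l + 2) + k + 1) * hc
        _ ≤ C * secondDegreeConst a (l + 2) (k + 1) * (a * (l + 2) + k + 1) *
            ((l + k + 2) ^ a * ((l + 2) * (1 + a) + (k + 1) + 2 * a - a)) :=
            mul_le_mul_of_nonneg_left hL (by positivity)
        _ = _ := by push_cast; ring

/-- The expected number of vertices is `c(l, k) n` up to an error of order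
`c(l, k) (l + k) ^ (1 + a)`. -/
theorem exists_abs_expectedNum_sub_le {a : ℝ} (ha : 0 < a) :
    ∃ C > 0, ∀ n l k : ℕ, |expectedNum a ha n l k - secondDegreeConst a l k * n| ≤
      C * (secondDegreeConst a l k * ((l : ℝ) + k) ^ (1 + a)) := by
  obtain ⟨C₁, hC₁, h₁⟩ := exists_abs_expectedSecondDegreeCount_sub_le ha
  obtain ⟨C₂, hC₂, h₂⟩ := exists_expectedSecondDegreeCount_loop_le ha
  have h1a : (1 + a) ≠ 0 := by positivity
  refine ⟨C₁ + C₂ * (1 + a) + 1, by positivity, fun n l k => ?_⟩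
  rcases l with _ | l
  · rw [expectedNum_eq, expectedSecondDegreeCount_eq_zero ha 0 (by omega),
      expectedSecondDegreeCount_eq_zero ha 1 (by omega), secondDegreeConst_zero_left]
    simp
  rcases k with _ | k
  · rw [expectedNum_eq, expectedSecondDegreeCount_eq_zero ha 0 (by omega),
      expectedSecondDegreeCount_eq_zero ha 1 (by omega), secondDegreeConst_zero_right]
    simp
  have e1 := h₁ n l (k + 1)
  have e2 := h₂ n l (k + 1)
  have e0 := expectedSecondDegreeCount_nonneg ha 1 n (l + 1) (k + 1)
  have hc := secondDegreeConst_nonneg ha (l + 1) (k + 1)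
  have hl : (0 : ℝ) ≤ l := Nat.cast_nonneg l
  have hk : (0 : ℝ) ≤ k := Nat.cast_nonneg k
  have hmono : ((l : ℝ) + (k + 1 : ℕ)) ^ (1 + a) ≤ ((l + 1 : ℕ) + (k + 1 : ℕ) : ℝ) ^ (1 + a) := by
    refine Real.rpow_le_rpow (by positivity) ?_ (by positivity)
    push_cast
    linarith
  have hlin : (a * (l + 1) + (k + 1 : ℕ)) * ((l : ℝ) + (k + 1 : ℕ)) ^ a ≤
      (1 + a) * ((l + 1 : ℕ) + (k + 1 : ℕ) : ℝ) ^ (1 + a) := by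
    refine le_trans ?_ (mul_le_mul_of_nonneg_left hmono (by positivity))
    rw [add_comm 1 a, Real.rpow_add_one (by positivity), mul_comm (_ ^ a), ← mul_assoc]
    refine mul_le_mul_of_nonneg_right ?_ (by positivity)
    push_cast
    nlinarith [mul_nonneg ha.le hk]
  have hone : (1 : ℝ) ≤ ((l + 1 : ℕ) + (k + 1 : ℕ) : ℝ) ^ (1 + a) := by
    refine Real.one_le_rpow ?_ (by positivity)
    push_cast
    linarith
  -- The main term was D/(1+a) = n + a/(1+a); the shift is absorbed in the error.
  have hsplit : expectedNum a ha n (l + 1) (k + 1) - secondDegreeConst a (l + 1) (k + 1) * n =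
      (expectedSecondDegreeCount a 0 n (l + 1) (k + 1) -
        secondDegreeConst a (l + 1) (k + 1) * (totalWeight a n / (1 + a))) +
      expectedSecondDegreeCount a 1 n (l + 1) (k + 1) +
      secondDegreeConst a (l + 1) (k + 1) * (a / (1 + a)) := by
    rw [expectedNum_eq, totalWeight_eq]
    field_simp
    ring
  have ha1 : a / (1 + a) ≤ 1 := (div_le_one (by positivity)).2 (by linarith)
  rw [hsplit]
  refine (abs_add_three _ _ _).trans ?_
  rw [abs_of_nonneg e0, abs_of_nonneg (show
    0 ≤ secondDegreeConst a (l + 1) (k + 1) * (a / (1 + a)) by positivity)]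
  set P := ((l + 1 : ℕ) + (k + 1 : ℕ) : ℝ) ^ (1 + a)
  calc _ ≤ C₁ * (secondDegreeConst a (l + 1) (k + 1) * P) +
        C₂ * (secondDegreeConst a (l + 1) (k + 1) * ((1 + a) * P)) +
        secondDegreeConst a (l + 1) (k + 1) * P := by
        refine add_le_add (add_le_add (e1.trans ?_) (e2.trans ?_)) ?_
        · gcongr
        · gcongr
        · exact mul_le_mul_of_nonneg_left (ha1.trans hone) hc
    _ = _ := by ring

end AttachmentGraph

theorem theorem4 (a : ℝ) (ha : 0 < a) :
    ∃ (C : ℝ) (θ : ℕ → ℕ → ℕ → ℝ), ∀ n l k : ℕ,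
      AttachmentGraph.expectedNum a ha n l k =
          secondDegreeConst a l k * ((n : ℝ) + θ n l k) ∧
        (0 < l + k → |θ n l k| < C * ((l : ℝ) + (k : ℝ)) ^ (1 + a)) := by
  obtain ⟨C, hC, h⟩ := AttachmentGraph.exists_abs_expectedNum_sub_le ha
  -- The added 1 makes the inequality strict. Where c(l,k) = 0, division by zero gives θ = 0, and
  -- the estimate forces the expectation to vanish.
  refine ⟨C + 1, fun n l k => (AttachmentGraph.expectedNum a ha n l k -
    secondDegreeConst a l k * n) / secondDegreeConst a l k, fun n l k => ?_⟩
  beta_reduce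
  have hnkl := h n l k
  rcases (secondDegreeConst_nonneg ha l k).eq_or_lt with hc | hc
  · rw [← hc] at hnkl ⊢
    simp only [zero_mul, mul_zero, sub_zero, abs_nonpos_iff] at hnkl
    refine ⟨by simpa using hnkl, fun hlk => ?_⟩
    have : (0 : ℝ) < l + k := by exact_mod_cast hlk
    rw [div_zero, abs_zero]
    positivity
  · refine ⟨by field_simp; ring, fun hlk => ?_⟩
    have hlk' : (0 : ℝ) < l + k := by exact_mod_cast hlk
    have hP : 0 < ((l : ℝ) + k) ^ (1 + a) := by positivity
    rw [abs_div, abs_of_pos hc, div_lt_iff₀ hc]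
    nlinarith [mul_pos hc hP]
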